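/- For each number $n$ of locations consider the model $$y_{ih}=z_{ih}^T\eta^0+x_{ih}^T\beta_i^0+\epsilon_{ih},\qquad i=1,\dots,n,\ h=1,\dots,n_i,\ n_i\ge 1,$$ with fixed covariates $z_{ih}\in\mathbb R^q$, $x_{ih}\in\mathbb R^p$. The locations are partitioned into $K$ nonempty groups $\mathcal G_1,\dots,\mathcal G_K$ and $\beta_i^0=\alpha_k^0$ for $i\in\mathcal G_k$. The errors $\epsilon_{ih}$ are, for each $n$, i.i.d. with mean $0$ and variance $\sigma^2>0$ ($\sigma$ not depending on $n$). The quantities $q,p,K,n_i$, the groups and the coefficients may depend on $n$. Let $Z$ have rows $z_{ih}^T$, $X=\mathrm{diag}(X_1,\dots,X_n)$ where $X_i$ has rows $x_{ih}^T$, $\widetilde W\in\{0,1\}^{n\times K}$ the group membership matrix, $W=\widetilde W\otimes I_p$, $U=(Z,XW)$, $\Omega=\mathrm{diag}(n_1^{-1}I_{n_1},\dots,n_n^{-1}I_{n_n})$, and let $|\mathcal G_{\min}|$ be the smallest group size. The objective function, with tuning parameter $\lambda=\lambda_n>0$, penalty $p_\gamma$ and (possibly data-dependent) weights $c_{ij}\ge0$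 (which may depend on a further parameter $\psi$), is $$Q_n(\eta,\beta)=\frac12\sum_{i=1}^n\frac1{n_i}\sum_{h=1}^{n_i}\bigl(y_{ih}-z_{ih}^T\eta-x_{ih}^T\beta_i\bigr)^2+\sum_{1\le i<j\le n}p_\gamma\bigl(\|\beta_i-\beta_j\|,c_{ij}\lambda\bigr).$$ The oracle estimator is $(\hat\eta^{or},\hat\alpha^{or})=(U^T\Omega U)^{-1}U^T\Omega y$, $\hat\beta^{or}=W\hat\alpha^{or}$. Assume, with positive constants $a,c_0,c_1,C_1,C_1',C_2,C_3,M_1,M_2,M_3$ not depending on $n$: (C1) $p_\gamma(\cdot,0)=0$, and for every $\lambda>0$ the function $\rho_\gamma(t)=\lambda^{-1}p_\gamma(t,\lambda)$ is symmetric, non-decreasing and concave on $[0,\infty)$, constant for $t\ge a\lambda$, $\rho_\gamma(0)=0$, $\rho_\gamma'$ exists and is continuous except at finitely many points, and $\rho_\gamma'(0+)=1$. (C2) For all large $n$: $|x_{ih,l}|\le M_1$, $|z_{ih,l}|\le M_1$, $M_2\le\max_i n_i/\min_i n_i\le M_3$, $\lambda_{\min}(U^T\Omega U)\ge C_1|\mathcal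 G_{\min}|$, $\lambda_{\max}(U^T\Omega U)\le C_1'n$, $\|x_{ih}\|\le C_2\sqrt p$, $\|z_{ih}\|\le C_3\sqrt q$. (C3) $P(|v^T\epsilon|>\|v\|x)\le2\exp(-c_1x^2)$ for every vector $v$ and every $x>0$. (C4) With probability tending to $1$, $c_{ij}\ge c_0$ for all $i<j$ in the same group. Assume also $q=o(n)$, $Kp=o(n)$, $$|\mathcal G_{\min}|\gg(q+Kp)^{1/2}\max\Bigl(\sqrt{\tfrac{n}{\min_i n_i}\log n},\,(q+Kp)^{1/2}\Bigr),$$ $\lambda_n\gg\phi_n$ with $$\phi_n=c_1^{-1/2}C_1^{-1}M_1\sqrt{q+Kp}\,|\mathcal G_{\min}|^{-1}\sqrt{\tfrac{n}{\min_i n_i}\log n},$$ and that, with probability tending to $1$, $\|\beta^0_i-\beta^0_j\|>a\,c_{ij}\lambda_n+2\phi_n$ for all $i<j$ in different groups (for weights $c_{ij}\le1$ this holds if the minimal group difference $b_n=\min_{k\ne k'}\|\alpha_k^0-\alpha_{k'}^0\|$ satisfies $b_n>a\lambda_n+2\phi_n$). Here $u_n\gg v_n$ means $v_n/u_n\to0$.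 Then there are random vectors $(\hat\eta(\lambda,\psi),\hat\beta(\lambda,\psi))$ and $\hat\alpha(\lambda,\psi)=(\hat\alpha_1,\dots,\hat\alpha_K)$ such that, with probability tending to $1$ as $n\to\infty$, $(\hat\eta(\lambda,\psi),\hat\beta(\lambda,\psi))$ is a local minimizer of $Q_n$, it equals $(\hat\eta^{or},\hat\beta^{or})$, and $\hat\alpha_1,\dots,\hat\alpha_K$ are the distinct vectors among $\hat\beta_1,\dots,\hat\beta_n$, with $\hat\beta_i=\hat\alpha_k$ for $i\in\mathcal G_k$; and, for any vectors $a_n\in\mathbb R^{q+Kp}$ that are nonzero for all large $n$, $$\sigma_n(a_n)^{-1}a_n^T\bigl((\hat\eta(\lambda,\psi)-\eta^0)^T,(\hat\alpha(\lambda,\psi)-\alpha^0)^T\bigr)^T\overset{d}{\to}N(0,1),$$ where $\sigma_n(a_n)=\sigma\bigl[a_n^T(U^T\Omega U)^{-1}U^T\Omega\Omega U(U^T\Omega U)^{-1}a_n\bigr]^{1/2}$. -/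

import Mathlib

open MeasureTheory ProbabilityTheory Filter Topology
open scoped Matrix Kronecker

/-- The non-random part of the model with `n` locations: location `i` has `m i ≥ 1` repeated
measures, `q` global covariates `z`, `p` local covariates `x`, and belongs to the group
`group i` among `K` nonempty groups; `η0` and `α0` are the true coefficients. -/
structure SpatialModel (n : ℕ) where
  K : ℕ
  p : ℕ
  q : ℕ
  m : Fin n → ℕ
  m_pos : ∀ i, 1 ≤ m i
  group : Fin n → Fin K
  group_surj : Function.Surjective group
  z : (i : Fin n) → Fin (m i) → EuclideanSpace ℝ (Fin q)
  x : (i : Fin n) → Fin (m i) → EuclideanSpace ℝ (Fin p)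
  η0 : EuclideanSpace ℝ (Fin q)
  α0 : Fin K → EuclideanSpace ℝ (Fin p)

noncomputable section

namespace SpatialModel

variable {n : ℕ} (D : SpatialModel n)

/-- Index set of the observations `(i, h)`. -/
abbrev Obs : Type := Σ i : Fin n, Fin (D.m i)

/-- Index set of the coordinates of `(η, α) ∈ ℝ^(q + K p)`. -/
abbrev Par : Type := Fin D.q ⊕ (Fin D.K × Fin D.p)

/-- `Z`, with rows `z_ihᵀ`. -/
def Zmat : Matrix D.Obs (Fin D.q) ℝ := Matrix.of fun s l => D.z s.1 s.2 l

/-- `X = diag(X_1, …, X_n)`, where `X_i` has rows `x_ihᵀ`. -/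
def Xmat : Matrix D.Obs (Fin n × Fin D.p) ℝ :=
  Matrix.of fun s jl => if s.1 = jl.1 then D.x s.1 s.2 jl.2 else 0

/-- The group membership matrix (`n × K`). -/
def Wtilde : Matrix (Fin n) (Fin D.K) ℝ :=
  Matrix.of fun i k => if D.group i = k then 1 else 0

/-- `W = W̃ ⊗ I_p`. -/
def Wmat : Matrix (Fin n × Fin D.p) (Fin D.K × Fin D.p) ℝ :=
  D.Wtilde ⊗ₖ (1 : Matrix (Fin D.p) (Fin D.p) ℝ)

/-- `U = (Z, X W)`. -/
def Umat : Matrix D.Obs D.Par ℝ := Matrix.fromCols D.Zmat (D.Xmat * D.Wmat)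

/-- `Ω = diag(n_1⁻¹ I, …, n_n⁻¹ I)`. -/
def Omega : Matrix D.Obs D.Obs ℝ := Matrix.diagonal fun s => ((D.m s.1 : ℝ))⁻¹

/-- `Uᵀ Ω U`. -/
def gram : Matrix D.Par D.Par ℝ := D.Umatᵀ * D.Omega * D.Umat

theorem gram_isHermitian : D.gram.IsHermitian := by
  unfold Matrix.IsHermitian gram Omega
  rw [Matrix.conjTranspose_eq_transpose_of_trivial]
  simp [Matrix.transpose_mul, Matrix.mul_assoc]

/-- `min_i n_i` (for `n ≥ 1`). -/
def minRep : ℕ := ⨅ i, D.m i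

/-- `max_i n_i`. -/
def maxRep : ℕ := ⨆ i, D.m i

/-- `|G_k|`. -/
def groupSize (k : Fin D.K) : ℕ := (Finset.univ.filter fun i => D.group i = k).card

/-- `|G_min|` (for `n ≥ 1`). -/
def minGroup : ℕ := ⨅ k, D.groupSize k

/-- The number `q + K p` of coefficients. -/
def dim : ℕ := D.q + D.K * D.p

/-- `φ_n`. -/
def phi (c₁ C₁ M₁ : ℝ) : ℝ :=
  (√c₁)⁻¹ * C₁⁻¹ * M₁ * √(D.dim : ℝ) * (D.minGroup : ℝ)⁻¹ *
    √((n : ℝ) / (D.minRep : ℝ) * Real.log n)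

/-- The responses `y_ih = z_ihᵀ η⁰ + x_ihᵀ β_i⁰ + ε_ih`, where `β_i⁰ = α⁰_k` for `i ∈ G_k`. -/
def response (e : D.Obs → ℝ) (s : D.Obs) : ℝ :=
  inner ℝ (D.z s.1 s.2) D.η0 + inner ℝ (D.x s.1 s.2) (D.α0 (D.group s.1)) + e s

/-- The objective `Q_n(η, β)` for responses `y`, penalty `pen`, weights `c` and tuning
parameter `lam`. -/
def objective (y : D.Obs → ℝ) (pen : ℝ → ℝ → ℝ) (c : Fin n → Fin n → ℝ) (lam : ℝ)
    (η : EuclideanSpace ℝ (Fin D.q)) (β : Fin n → EuclideanSpace ℝ (Fin D.p)) : ℝ :=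
  (1 / 2) * ∑ i, (1 / (D.m i : ℝ)) *
      ∑ h, (y ⟨i, h⟩ - inner ℝ (D.z i h) η - inner ℝ (D.x i h) (β i)) ^ 2
    + ∑ i, ∑ j ∈ Finset.univ.filter (fun j => i < j), pen ‖β i - β j‖ (c i j * lam)

/-- The oracle estimator of `(η, α)`, `(Uᵀ Ω U)⁻¹ Uᵀ Ω y`. -/
def oracle (y : D.Obs → ℝ) : D.Par → ℝ :=
  D.gram⁻¹ *ᵥ (D.Umatᵀ *ᵥ (D.Omega *ᵥ y))

/-- The oracle estimator of `η`. -/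
def oracleEta (y : D.Obs → ℝ) : EuclideanSpace ℝ (Fin D.q) :=
  WithLp.toLp 2 fun l => D.oracle y (Sum.inl l)

/-- The oracle estimator of `α`. -/
def oracleAlpha (y : D.Obs → ℝ) (k : Fin D.K) : EuclideanSpace ℝ (Fin D.p) :=
  WithLp.toLp 2 fun l => D.oracle y (Sum.inr (k, l))

/-- The oracle estimator of `β`, that is, `W` applied to the oracle estimator of `α`. -/
def oracleBeta (y : D.Obs → ℝ) (i : Fin n) : EuclideanSpace ℝ (Fin D.p) :=
  D.oracleAlpha y (D.group i)

/-- `α` lists the distinct vectors among `β_1, …, β_n`, each once, with the vector shared by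
the locations of `G_k` in position `k`. -/
def IsDistinctGroupVectors (β : Fin n → EuclideanSpace ℝ (Fin D.p))
    (α : Fin D.K → EuclideanSpace ℝ (Fin D.p)) : Prop :=
  Function.Injective α ∧ Set.range α = Set.range β ∧ ∀ i, β i = α (D.group i)

/-- The vector `(η - η⁰, α - α⁰) ∈ ℝ^(q + K p)`. -/
def deviation (η : EuclideanSpace ℝ (Fin D.q)) (α : Fin D.K → EuclideanSpace ℝ (Fin D.p)) :
    D.Par → ℝ :=
  Sum.elim (fun l => η l - D.η0 l) (fun kl => α kl.1 kl.2 - D.α0 kl.1 kl.2)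

/-- `σ_n(a) = σ [aᵀ (UᵀΩU)⁻¹ UᵀΩΩU (UᵀΩU)⁻¹ a]^(1/2)`. -/
def sigmaN (σ : ℝ) (a : D.Par → ℝ) : ℝ :=
  σ * √(a ⬝ᵥ ((D.gram⁻¹ * (D.Umatᵀ * D.Omega * D.Omega * D.Umat) * D.gram⁻¹) *ᵥ a))

/-- Condition (C2): bounded covariates, balanced numbers of repeated measures, and bounds on the
eigenvalues of `UᵀΩU`. -/
structure CovariateCondition (M₁ M₂ M₃ C₁ C₁' C₂ C₃ : ℝ) : Prop where
  x_bdd : ∀ i h l, |D.x i h l| ≤ M₁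
  z_bdd : ∀ i h l, |D.z i h l| ≤ M₁
  rep_lower : M₂ ≤ (D.maxRep : ℝ) / (D.minRep : ℝ)
  rep_upper : (D.maxRep : ℝ) / (D.minRep : ℝ) ≤ M₃
  eig_lower : ∀ r, C₁ * (D.minGroup : ℝ) ≤ D.gram_isHermitian.eigenvalues r
  eig_upper : ∀ r, D.gram_isHermitian.eigenvalues r ≤ C₁' * (n : ℝ)
  x_norm : ∀ i h, ‖D.x i h‖ ≤ C₂ * √(D.p : ℝ)
  z_norm : ∀ i h, ‖D.z i h‖ ≤ C₃ * √(D.q : ℝ)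

end SpatialModel

/-- Condition (C1) on the penalty `pen t lam`, where `ρ t = lam⁻¹ * pen t lam` for `lam > 0`;
`pen` vanishes for `lam = 0`. -/
structure PenaltyCondition (pen : ℝ → ℝ → ℝ) (a : ℝ) : Prop where
  tuning_zero : ∀ t, pen t 0 = 0
  symmetric : ∀ lam, 0 < lam → ∀ t, lam⁻¹ * pen (-t) lam = lam⁻¹ * pen t lam
  monotone : ∀ lam, 0 < lam → MonotoneOn (fun t => lam⁻¹ * pen t lam) (Set.Ici 0)
  concave : ∀ lam, 0 < lam → ConcaveOn ℝ (Set.Ici 0) (fun t => lam⁻¹ * pen t lam)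
  flat : ∀ lam, 0 < lam → ∀ t, a * lam ≤ t → lam⁻¹ * pen t lam = lam⁻¹ * pen (a * lam) lam
  at_zero : ∀ lam, 0 < lam → lam⁻¹ * pen 0 lam = 0
  smooth : ∀ lam, 0 < lam → ∃ S : Set ℝ, S.Finite ∧ ∀ t, t ∉ S →
    DifferentiableAt ℝ (fun t => lam⁻¹ * pen t lam) t ∧
    ContinuousAt (deriv fun t => lam⁻¹ * pen t lam) t
  deriv_zero : ∀ lam, 0 < lam →
    Tendsto (deriv fun t => lam⁻¹ * pen t lam) (𝓝[>] 0) (𝓝 1)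

/-- Errors that are i.i.d. with mean `0` and variance `σ²`. -/
structure ErrorModel {ι Ω : Type*} [MeasurableSpace Ω] (P : Measure Ω) (σ : ℝ)
    (ε : ι → Ω → ℝ) : Prop where
  meas : ∀ s, Measurable (ε s)
  indep : iIndepFun ε P
  ident : ∀ s t, IdentDistrib (ε s) (ε t) P P
  mean : ∀ s, ∫ ω, ε s ω ∂P = 0
  var : ∀ s, variance (ε s) P = σ ^ 2

/-- Condition (C3): sub-Gaussian tails of all linear combinations of the errors. -/
def SubGaussianTails {ι Ω : Type*} [Fintype ι] [MeasurableSpace Ω] (P : Measure Ω) (c₁ : ℝ)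
    (ε : ι → Ω → ℝ) : Prop :=
  ∀ (v : EuclideanSpace ℝ ι) (x : ℝ), 0 < x →
    P {ω | ‖v‖ * x < |∑ s, v s * ε s ω|} ≤ ENNReal.ofReal (2 * Real.exp (-c₁ * x ^ 2))

end

/-! The estimator is taken to be the oracle itself, so the work is to show that the oracle is a
local minimizer with high probability and that its linear functionals are asymptotically normal.

Local minimality is a first-order comparison of loss and penalty. By the normal equations the
gradient of the loss in η vanishes at the oracle, and the local scores of the residuals sum to zero
over every group. The loss is a convex quadratic, so moving from the oracle to (η, β) lowers it by
at most the sum of the inner products of scores and β_i. Since the scores cancel within groups, only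
differences β_i - β_j inside a group matter (`sum_inner_le_of_group_sum_eq_zero`,
`lossPart_oracle_le`). The penalty has slope near 1 at the origin, so each pair inside a group pays
at least c₀λ/2 times its distance (`exists_linear_lower_bound`). Pairs in different groups lie
strictly in the flat region of the penalty and contribute no change. The penalty therefore wins once
every score is at most |G_min| c₀λ/4 (`isLocalMin_objective_oracle`).

The score bound is probabilistic. Union bounds over sub-Gaussian linear forms control the
coordinates of UᵀΩε and the scores of ε. Coercivity of UᵀΩU turns the former into an oracle error of
at most φ_n (`sq_error_le`), which also preserves the separation of the groups. The residual scores
are then at most a constant times φ_n |G_min|, because q + Kp = o(|G_min|), and φ_n = o(λ_n)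
finishes the comparison.

For normality, the normalized deviation is a weighted sum of the errors. Coercivity and the row
bounds on U show that no squared weight exceeds a constant times (q + Kp)/|G_min| of the total
(`sq_errorWeight_le`). Sub-Gaussian tails bound the third moments uniformly, so a Lyapunov argument
with characteristic functions applies (`tendsto_charFun_weighted_sum`). -/

noncomputable section

/-! ### Central limit theorem for weighted sums, by characteristic functions. -/

section CentralLimit

variable {Ω : Type*} [MeasurableSpace Ω] {P : Measure Ω}

/-- Quadratic Taylor bound for the imaginary exponential. -/
theorem norm_exp_mul_I_sub_quadratic_le (y : ℝ) :
    ‖Complex.exp (y * Complex.I) - (1 + y * Complex.I - (y : ℂ) ^ 2 / 2)‖ ≤ 4 * |y| ^ 3 := by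
  have hn : ‖(y : ℂ) * Complex.I‖ = |y| := by simp
  rcases le_or_gt |y| 1 with h | h
  · have hb := Complex.exp_bound (x := y * Complex.I) (by rwa [hn]) (n := 3) (by norm_num)
    rw [hn] at hb
    have hs : ∑ m ∈ Finset.range 3, ((y : ℂ) * Complex.I) ^ m / (m.factorial : ℂ) =
        1 + y * Complex.I - (y : ℂ) ^ 2 / 2 := by
      simp only [Finset.sum_range_succ, Finset.sum_range_zero, Nat.factorial, mul_pow,
        Complex.I_sq]
      push_cast
      ring
    rw [hs] at hb
    refine hb.trans ?_
    have h3 : 0 ≤ |y| ^ 3 := by positivity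
    norm_num [Nat.factorial]
    linarith
  -- For |y| > 1 no cancellation is needed: each term separately is bounded by a multiple of |y|³.
  · have h1 : ‖Complex.exp (y * Complex.I)‖ = 1 := Complex.norm_exp_ofReal_mul_I y
    have h2 : ‖(1 + y * Complex.I - (y : ℂ) ^ 2 / 2)‖ ≤ 1 + |y| + |y| ^ 2 / 2 := by
      refine (norm_sub_le _ _).trans (add_le_add ((norm_add_le _ _).trans ?_) ?_)
      · rw [hn]; simp
      · simp
    refine (norm_sub_le _ _).trans ?_
    have h4 : |y| ≤ |y| ^ 3 := le_self_pow₀ h.le (by norm_num)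
    have h5 : |y| ^ 2 ≤ |y| ^ 3 := pow_le_pow_right₀ h.le (by norm_num)
    rw [h1]
    linarith

/-- Factors are exchanged one at a time; the untouched factors lie in the unit disc and do not
enlarge the difference. -/
theorem norm_prod_sub_prod_le_sum {ι : Type*} (s : Finset ι) (f g : ι → ℂ)
    (hf : ∀ i ∈ s, ‖f i‖ ≤ 1) (hg : ∀ i ∈ s, ‖g i‖ ≤ 1) :
    ‖∏ i ∈ s, f i - ∏ i ∈ s, g i‖ ≤ ∑ i ∈ s, ‖f i - g i‖ := by
  classical
  induction s using Finset.induction_on with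
  | empty => simp
  | insert a s ha ih =>
    rw [Finset.prod_insert ha, Finset.prod_insert ha, Finset.sum_insert ha]
    have hfs : ‖∏ i ∈ s, f i‖ ≤ 1 := by
      rw [norm_prod]
      exact Finset.prod_le_one (fun _ _ => norm_nonneg _)
        fun i hi => hf i (Finset.mem_insert_of_mem hi)
    have heq : f a * ∏ i ∈ s, f i - g a * ∏ i ∈ s, g i =
        (f a - g a) * ∏ i ∈ s, f i + g a * (∏ i ∈ s, f i - ∏ i ∈ s, g i) := by ring
    rw [heq]
    refine (norm_add_le _ _).trans (add_le_add ?_ ?_)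
    · rw [norm_mul]
      exact mul_le_of_le_one_right (norm_nonneg _) hfs
    · rw [norm_mul]
      refine (mul_le_of_le_one_left (norm_nonneg _) (hg a (Finset.mem_insert_self _ _))).trans ?_
      exact ih (fun i hi => hf i (Finset.mem_insert_of_mem hi))
        fun i hi => hg i (Finset.mem_insert_of_mem hi)

/-- The Taylor bound is integrated at y = uX; the first two moments turn the Taylor polynomial into
the stated quadratic. -/
theorem norm_charFun_sub_quadratic_le [IsProbabilityMeasure P] {X : Ω → ℝ} (hX : Measurable X)
    {σ C : ℝ} (h2 : Integrable (fun ω => X ω ^ 2) P) (h3 : Integrable (fun ω => |X ω| ^ 3) P)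
    (hmean : ∫ ω, X ω ∂P = 0) (hvar : ∫ ω, X ω ^ 2 ∂P = σ ^ 2)
    (hC : ∫ ω, |X ω| ^ 3 ∂P ≤ C) (u : ℝ) :
    ‖charFun (P.map X) u - ((1 - σ ^ 2 * u ^ 2 / 2 : ℝ) : ℂ)‖ ≤ 4 * C * |u| ^ 3 := by
  have h1 : Integrable X P := by
    have : MemLp X 2 P := (memLp_two_iff_integrable_sq hX.aestronglyMeasurable).2 h2
    exact this.integrable (by norm_num)
  have e1 : charFun (P.map X) u = ∫ ω, Complex.exp ((u * X ω : ℝ) * Complex.I) ∂P := by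
    rw [charFun_apply_real, integral_map hX.aemeasurable (by fun_prop)]
    simp
  have i1 : Integrable (fun ω => Complex.exp ((u * X ω : ℝ) * Complex.I)) P := by
    refine Integrable.of_bound (C := 1) (by fun_prop) ?_
    exact Eventually.of_forall fun ω => (Complex.norm_exp_ofReal_mul_I _).le
  have i2 : Integrable (fun ω => ((u * X ω : ℝ) : ℂ) * Complex.I) P :=
    ((h1.const_mul u).ofReal (𝕜 := ℂ)).mul_const _
  have i3 : Integrable (fun ω => ((u * X ω : ℝ) : ℂ) ^ 2 / 2) P := by
    have : (fun ω => ((u * X ω : ℝ) : ℂ) ^ 2 / 2) =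
        fun ω => ((u ^ 2 / 2 * X ω ^ 2 : ℝ) : ℂ) := by
      funext ω; push_cast; ring
    rw [this]
    exact (h2.const_mul _).ofReal
  have i4 : Integrable (fun ω => 1 + ((u * X ω : ℝ) : ℂ) * Complex.I) P :=
    (integrable_const _).add i2
  have i5 : Integrable
      (fun ω => 1 + ((u * X ω : ℝ) : ℂ) * Complex.I - ((u * X ω : ℝ) : ℂ) ^ 2 / 2) P := i4.sub i3
  have e2 : ∫ ω, (1 + ((u * X ω : ℝ) : ℂ) * Complex.I - ((u * X ω : ℝ) : ℂ) ^ 2 / 2) ∂P =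
      ((1 - σ ^ 2 * u ^ 2 / 2 : ℝ) : ℂ) := by
    rw [integral_sub i4 i3, integral_add (integrable_const _) i2,
      integral_mul_const]
    have : (fun ω => ((u * X ω : ℝ) : ℂ) ^ 2 / 2) =
        fun ω => ((u ^ 2 / 2 * X ω ^ 2 : ℝ) : ℂ) := by
      funext ω; push_cast; ring
    rw [this, integral_complex_ofReal, integral_complex_ofReal, integral_const_mul,
      integral_const_mul, hmean, hvar]
    simp
    ring
  rw [e1, ← e2, ← integral_sub i1 i5]
  refine (norm_integral_le_of_norm_le (g := fun ω => 4 * |u| ^ 3 * |X ω| ^ 3)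
    (h3.const_mul _) (Eventually.of_forall fun ω => ?_)).trans ?_
  · refine (norm_exp_mul_I_sub_quadratic_le (u * X ω)).trans ?_
    rw [abs_mul, mul_pow, mul_assoc]
  · rw [integral_const_mul]
    have : 0 ≤ 4 * |u| ^ 3 := by positivity
    nlinarith

/-- A central limit theorem of Lyapunov type for weighted sums in a triangular array. -/
theorem tendsto_charFun_weighted_sum [IsProbabilityMeasure P] {ι : ℕ → Type*}
    [∀ n, Fintype (ι n)] {ε : (n : ℕ) → ι n → Ω → ℝ} {w : (n : ℕ) → ι n → ℝ} {σ C : ℝ}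
    (hmeas : ∀ n s, Measurable (ε n s)) (hindep : ∀ n, iIndepFun (ε n) P)
    (h2 : ∀ n s, Integrable (fun ω => ε n s ω ^ 2) P)
    (h3 : ∀ n s, Integrable (fun ω => |ε n s ω| ^ 3) P)
    (hmean : ∀ n s, ∫ ω, ε n s ω ∂P = 0) (hvar : ∀ n s, ∫ ω, ε n s ω ^ 2 ∂P = σ ^ 2)
    (hC : ∀ n s, ∫ ω, |ε n s ω| ^ 3 ∂P ≤ C) (hσ : 0 < σ)
    (hw : ∀ᶠ n in atTop, σ ^ 2 * ∑ s, w n s ^ 2 = 1)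
    (hmax : ∀ δ > 0, ∀ᶠ n in atTop, ∀ s, |w n s| ≤ δ) (t : ℝ) :
    Tendsto (fun n => charFun (P.map fun ω => ∑ s, w n s * ε n s ω) t) atTop
      (𝓝 (charFun (gaussianReal 0 1) t)) := by
  have hC0 : 0 ≤ |C| := abs_nonneg C
  -- When all weights are at most δ, the cubic Taylor error and the error of 1 - x against exp(-x)
  -- add up to at most Aδ times the variance share σ²w². The shares sum to 1, so Aδ bounds the
  -- total.
  set A : ℝ := 4 * |C| * |t| ^ 3 / σ ^ 2 + σ ^ 2 * t ^ 4 / 4 with hA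
  have hA0 : 0 ≤ A := by positivity
  rw [Metric.tendsto_nhds]
  intro r hr
  obtain ⟨δ, hδ, hδ1, hδ2, hδ3⟩ : ∃ δ : ℝ, 0 < δ ∧ δ ≤ 1 ∧ A * δ < r ∧
      σ ^ 2 * δ * t ^ 2 / 2 ≤ 1 := by
    refine ⟨min 1 (min (r / (A + 1) / 2) (1 / (σ ^ 2 * t ^ 2 + 1))), by positivity,
      min_le_left _ _, ?_, ?_⟩
    · have := (min_le_right (1 : ℝ) _).trans (min_le_left (r / (A + 1) / 2)
        (1 / (σ ^ 2 * t ^ 2 + 1)))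
      calc _ ≤ A * (r / (A + 1) / 2) := by gcongr
        _ < r := by
          rw [div_div, mul_div_assoc', div_lt_iff₀ (by positivity)]
          nlinarith
    · have := (min_le_right (1 : ℝ) _).trans (min_le_right (r / (A + 1) / 2)
        (1 / (σ ^ 2 * t ^ 2 + 1)))
      calc _ ≤ σ ^ 2 * (1 / (σ ^ 2 * t ^ 2 + 1)) * t ^ 2 / 2 := by gcongr
        _ ≤ 1 := by
          rw [mul_one_div, div_mul_eq_mul_div, div_div, div_le_one (by positivity)]
          nlinarith [sq_nonneg (σ * t)]
  filter_upwards [hw, hmax δ hδ] with n hn hnδ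
  have e1 : charFun (P.map fun ω => ∑ s, w n s * ε n s ω) t =
      ∏ s, charFun (P.map (ε n s)) (w n s * t) := by
    have hi : iIndepFun (fun s ω => w n s * ε n s ω) P :=
      (hindep n).comp (fun s x => w n s * x) fun s => by fun_prop
    rw [hi.charFun_map_fun_sum_eq_prod fun s => ((hmeas n s).const_mul _).aemeasurable,
      Finset.prod_apply]
    exact Finset.prod_congr rfl fun s _ => charFun_map_mul_comp (hmeas n s).aemeasurable _ _
  -- The Gaussian characteristic function is split along the variance shares, so that both sides are
  -- products over the same index set.
  have e2 : charFun (gaussianReal 0 1) t =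
      ∏ s, ((Real.exp (-(σ ^ 2 * (w n s * t) ^ 2 / 2)) : ℝ) : ℂ) := by
    rw [charFun_gaussianReal, ← Complex.ofReal_prod, ← Real.exp_sum, Finset.sum_neg_distrib,
      ← Finset.sum_div, ← Finset.mul_sum]
    simp_rw [mul_pow]
    rw [← Finset.sum_mul, ← mul_assoc, hn]
    push_cast
    congr 1
    simp
  rw [e1, e2, dist_eq_norm]
  refine (norm_prod_sub_prod_le_sum _ _ _ (fun s _ => ?_) fun s _ => ?_).trans_lt ?_
  · have := Measure.isProbabilityMeasure_map (μ := P) (hmeas n s).aemeasurable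
    exact norm_charFun_le_one _
  · rw [Complex.norm_real, Real.norm_eq_abs, abs_of_pos (Real.exp_pos _), Real.exp_le_one_iff]
    have : 0 ≤ σ ^ 2 * (w n s * t) ^ 2 / 2 := by positivity
    linarith
  · have hterm : ∀ s, ‖charFun (P.map (ε n s)) (w n s * t) -
        ((Real.exp (-(σ ^ 2 * (w n s * t) ^ 2 / 2)) : ℝ) : ℂ)‖ ≤
        (A * δ) * (σ ^ 2 * w n s ^ 2) := by
      intro s
      have b1 := norm_charFun_sub_quadratic_le (hmeas n s) (h2 n s) (h3 n s) (hmean n s)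
        (hvar n s) ((hC n s).trans (le_abs_self C)) (w n s * t)
      set x : ℝ := σ ^ 2 * (w n s * t) ^ 2 / 2 with hx
      have hw2 : w n s ^ 2 ≤ δ * |w n s| := by
        rw [← sq_abs, sq]; exact mul_le_mul_of_nonneg_right (hnδ s) (abs_nonneg _)
      have hw2' : w n s ^ 2 ≤ δ := by
        nlinarith [hnδ s, abs_nonneg (w n s)]
      have hx0 : 0 ≤ x := by positivity
      have hx1 : x ≤ 1 := by
        refine le_trans ?_ hδ3
        rw [hx, mul_pow, ← mul_assoc]
        gcongr
      have b2 : ‖((1 - x : ℝ) : ℂ) - ((Real.exp (-x) : ℝ) : ℂ)‖ ≤ x ^ 2 := by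
        rw [← Complex.ofReal_sub, Complex.norm_real, Real.norm_eq_abs, abs_sub_comm]
        have := Real.abs_exp_sub_one_sub_id_le (x := -x) (by rwa [abs_neg, abs_of_nonneg hx0])
        rw [neg_sq] at this
        convert this using 2
        ring
      refine (norm_sub_le_norm_sub_add_norm_sub _ ((1 - x : ℝ) : ℂ) _).trans
        ((add_le_add b1 b2).trans ?_)
      have hw3 : |w n s| ^ 3 ≤ δ * w n s ^ 2 := by
        rw [pow_succ, sq_abs, mul_comm]
        exact mul_le_mul_of_nonneg_right (hnδ s) (sq_nonneg _)
      have hw4 : w n s ^ 4 ≤ δ * w n s ^ 2 := by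
        have : w n s ^ 4 = w n s ^ 2 * w n s ^ 2 := by ring
        rw [this]
        exact mul_le_mul_of_nonneg_right hw2' (sq_nonneg _)
      calc 4 * |C| * |w n s * t| ^ 3 + x ^ 2
          = 4 * |C| * |t| ^ 3 * |w n s| ^ 3 + σ ^ 4 * t ^ 4 / 4 * w n s ^ 4 := by
            rw [hx, abs_mul]; ring
        _ ≤ 4 * |C| * |t| ^ 3 * (δ * w n s ^ 2) + σ ^ 4 * t ^ 4 / 4 * (δ * w n s ^ 2) := by
            gcongr
        _ = A * δ * (σ ^ 2 * w n s ^ 2) := by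
            rw [hA]; field_simp
    refine (Finset.sum_le_sum fun s _ => hterm s).trans_lt ?_
    rw [← Finset.mul_sum, ← Finset.mul_sum, hn, mul_one]
    exact hδ2

/-- The third absolute moment of a variable with sub-Gaussian tails is bounded in terms of the
tail constant only. -/
theorem exists_third_moment_bound {c₁ : ℝ} (hc₁ : 0 < c₁) :
    ∃ C : ℝ, ∀ X : Ω → ℝ, Measurable X →
      (∀ x, 0 < x → P {ω | x < |X ω|} ≤ ENNReal.ofReal (2 * Real.exp (-c₁ * x ^ 2))) →
      Integrable (fun ω => |X ω| ^ 3) P ∧ ∫ ω, |X ω| ^ 3 ∂P ≤ C := by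
  have hint : Integrable (fun t : ℝ => 2 * (t ^ 2 * Real.exp (-c₁ * t ^ 2))) := by
    have := integrable_rpow_mul_exp_neg_mul_sq hc₁ (s := 2) (by norm_num)
    simpa using this.const_mul 2
  -- The layer-cake formula for the third moment, with the tail probability replaced by its bound;
  -- only c₁ enters.
  set B : ENNReal := ENNReal.ofReal 3 *
    ∫⁻ t in Set.Ioi (0 : ℝ), ENNReal.ofReal (2 * (t ^ 2 * Real.exp (-c₁ * t ^ 2))) with hB
  have hBtop : B ≠ ⊤ := by
    refine ENNReal.mul_ne_top ENNReal.ofReal_ne_top ?_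
    exact hint.integrableOn.lintegral_lt_top.ne
  refine ⟨B.toReal, fun X hX htail => ?_⟩
  have key : ∫⁻ ω, ENNReal.ofReal (|X ω| ^ 3) ∂P ≤ B := by
    have h := lintegral_rpow_eq_lintegral_meas_lt_mul P (f := fun ω => |X ω|)
      (Eventually.of_forall fun ω => abs_nonneg _) (by fun_prop) (p := 3) (by norm_num)
    have h' : ∫⁻ ω, ENNReal.ofReal (|X ω| ^ 3) ∂P = ∫⁻ ω, ENNReal.ofReal (|X ω| ^ (3 : ℝ)) ∂P := by
      refine lintegral_congr fun ω => ?_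
      norm_cast
    rw [h', h, hB]
    refine mul_le_mul' le_rfl (setLIntegral_mono' measurableSet_Ioi fun t ht => ?_)
    calc _ ≤ ENNReal.ofReal (2 * Real.exp (-c₁ * t ^ 2)) * ENNReal.ofReal (t ^ ((3 : ℝ) - 1)) := by
          gcongr
          exact htail t ht
      _ = _ := by
          rw [← ENNReal.ofReal_mul (by positivity)]
          congr 1
          norm_num
          ring
  have hmeas : AEStronglyMeasurable (fun ω => |X ω| ^ 3) P := by fun_prop
  have hnn : 0 ≤ᵐ[P] fun ω => |X ω| ^ 3 := Eventually.of_forall fun ω => by positivity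
  refine ⟨⟨hmeas, (hasFiniteIntegral_iff_ofReal hnn).2 (key.trans_lt hBtop.lt_top)⟩, ?_⟩
  rw [integral_eq_lintegral_of_nonneg_ae hnn hmeas]
  exact ENNReal.toReal_mono hBtop key

end CentralLimit

/-! ### Coercive matrices and sums over pairs within groups. -/

section LinearAlgebra

/-- Both sides are diagonal in the orthonormal eigenbasis, where the inequality holds term by term.
-/
theorem mul_dotProduct_le_of_le_eigenvalues {ι : Type*} [Fintype ι] [DecidableEq ι]
    {A : Matrix ι ι ℝ} (hA : A.IsHermitian) {c : ℝ} (hc : ∀ r, c ≤ hA.eigenvalues r)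
    (b : ι → ℝ) : c * (b ⬝ᵥ b) ≤ b ⬝ᵥ (A *ᵥ b) := by
  have hcoord : ∀ r, (hA.eigenvectorBasis r).ofLp ⬝ᵥ (A *ᵥ b) =
      hA.eigenvalues r * ((hA.eigenvectorBasis r).ofLp ⬝ᵥ b) := by
    intro r
    have hT : Aᵀ = A := by
      rw [← Matrix.conjTranspose_eq_transpose_of_trivial]; exact hA
    rw [Matrix.dotProduct_mulVec, ← Matrix.mulVec_transpose, hT, hA.mulVec_eigenvectorBasis,
      smul_dotProduct, smul_eq_mul]
  have hin : ∀ u v : ι → ℝ, u ⬝ᵥ v =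
      ∑ r, ((hA.eigenvectorBasis r).ofLp ⬝ᵥ u) * ((hA.eigenvectorBasis r).ofLp ⬝ᵥ v) := by
    intro u v
    have := hA.eigenvectorBasis.sum_inner_mul_inner (WithLp.toLp 2 u) (WithLp.toLp 2 v)
    simp only [EuclideanSpace.inner_eq_star_dotProduct, star_trivial] at this
    rw [dotProduct_comm, ← this]
    exact Finset.sum_congr rfl fun r _ => by rw [dotProduct_comm v]
  rw [hin b b, hin b (A *ᵥ b), Finset.mul_sum]
  refine Finset.sum_le_sum fun r _ => ?_
  rw [hcoord]
  nlinarith [hc r, mul_self_nonneg ((hA.eigenvectorBasis r).ofLp ⬝ᵥ b)]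

/-- Cauchy–Schwarz applied to the quadratic form. It bounds a solution of Ab = g by g without any
norm of the inverse. -/
theorem sq_mul_dotProduct_le_of_coercive {ι : Type*} [Fintype ι] {A : Matrix ι ι ℝ} {c : ℝ}
    (hc : 0 ≤ c) (hA : ∀ b, c * (b ⬝ᵥ b) ≤ b ⬝ᵥ (A *ᵥ b)) (b : ι → ℝ) :
    c ^ 2 * (b ⬝ᵥ b) ≤ (A *ᵥ b) ⬝ᵥ (A *ᵥ b) := by
  have h0 : 0 ≤ b ⬝ᵥ b := Finset.sum_nonneg fun i _ => mul_self_nonneg _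
  have h1 : 0 ≤ (A *ᵥ b) ⬝ᵥ (A *ᵥ b) := Finset.sum_nonneg fun i _ => mul_self_nonneg _
  have hcs : (b ⬝ᵥ (A *ᵥ b)) ^ 2 ≤ (b ⬝ᵥ b) * ((A *ᵥ b) ⬝ᵥ (A *ᵥ b)) := by
    have := Finset.sum_mul_sq_le_sq_mul_sq Finset.univ b (A *ᵥ b)
    simpa only [dotProduct, ← sq] using this
  rcases h0.eq_or_lt with h | h
  · rw [← h]; simpa using h1
  · have h2 : (c * (b ⬝ᵥ b)) ^ 2 ≤ (b ⬝ᵥ (A *ᵥ b)) ^ 2 :=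
      pow_le_pow_left₀ (by positivity) (hA b) 2
    have h3 : (b ⬝ᵥ b) * (c ^ 2 * (b ⬝ᵥ b)) ≤ (b ⬝ᵥ b) * ((A *ᵥ b) ⬝ᵥ (A *ᵥ b)) := by
      nlinarith
    exact le_of_mul_le_mul_left h3 h

theorem sum_sum_eq_two_mul_sum_lt {n : ℕ} (f : Fin n → Fin n → ℝ) (hdiag : ∀ i, f i i = 0)
    (hsymm : ∀ i j, f i j = f j i) :
    ∑ i, ∑ j, f i j = 2 * ∑ i, ∑ j ∈ Finset.univ.filter (fun j => i < j), f i j := by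
  simp_rw [Finset.sum_filter]
  have h1 : ∀ i j, f i j = (if i < j then f i j else 0) + (if j < i then f j i else 0) := by
    intro i j
    rcases lt_trichotomy i j with h | h | h
    · simp [h, h.not_gt]
    · subst h; simp [hdiag]
    · simp [h, h.not_gt, hsymm i j]
  have h2 : ∑ i, ∑ j, f i j = ∑ i, ∑ j, (if i < j then f i j else 0) +
      ∑ i, ∑ j, (if j < i then f j i else 0) := by
    rw [← Finset.sum_add_distrib]
    refine Finset.sum_congr rfl fun i _ => ?_
    rw [← Finset.sum_add_distrib]
    exact Finset.sum_congr rfl fun j _ => h1 i j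
  rw [h2, Finset.sum_comm (f := fun i j => if j < i then f j i else 0), two_mul]

/-- If the vectors `g i` sum to zero on every group, then `∑ ⟪g i, β i⟫` is controlled by the
within-group differences of `β`. -/
theorem sum_inner_le_of_group_sum_eq_zero {n K : ℕ} {E : Type*} [NormedAddCommGroup E]
    [InnerProductSpace ℝ E] (grp : Fin n → Fin K) (g β : Fin n → E)
    (hz : ∀ k, ∑ i ∈ Finset.univ.filter (fun i => grp i = k), g i = 0) {B : ℝ}
    (hB : ∀ i, ‖g i‖ ≤ ((Finset.univ.filter fun j => grp j = grp i).card : ℝ) * B) :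
    ∑ i, inner ℝ (g i) (β i) ≤
      2 * B * ∑ i, ∑ j ∈ Finset.univ.filter (fun j => i < j),
        if grp i = grp j then ‖β i - β j‖ else 0 := by
  set N : Fin n → ℝ := fun i => ((Finset.univ.filter fun j => grp j = grp i).card : ℝ) with hN
  have hNpos : ∀ i, 0 < N i := fun i => by
    simp only [hN, Nat.cast_pos, Finset.card_pos]
    exact ⟨i, by simp⟩
  -- Pairing g i with the group mean of β gives zero in total, so each β i may be replaced by its
  -- average difference from its own group.
  have hzero : ∑ i, ∑ j, (if grp i = grp j then (N i)⁻¹ * inner ℝ (g i) (β j) else 0) = 0 := by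
    rw [Finset.sum_comm]
    refine Finset.sum_eq_zero fun j _ => ?_
    have : ∀ i, (if grp i = grp j then (N i)⁻¹ * inner ℝ (g i) (β j) else 0) =
        (N j)⁻¹ * (if grp i = grp j then inner ℝ (g i) (β j) else 0) := by
      intro i
      split_ifs with h
      · simp only [hN, h]
      · simp
    simp_rw [this]
    rw [← Finset.mul_sum, ← Finset.sum_filter, ← sum_inner, hz, inner_zero_left, mul_zero]
  have hmain : ∀ i, inner ℝ (g i) (β i) =
      ∑ j, (if grp i = grp j then (N i)⁻¹ * inner ℝ (g i) (β i - β j) else 0) +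
      ∑ j, (if grp i = grp j then (N i)⁻¹ * inner ℝ (g i) (β j) else 0) := by
    intro i
    rw [← Finset.sum_add_distrib]
    have : ∀ j, ((if grp i = grp j then (N i)⁻¹ * inner ℝ (g i) (β i - β j) else 0) +
        (if grp i = grp j then (N i)⁻¹ * inner ℝ (g i) (β j) else 0)) =
        if grp j = grp i then (N i)⁻¹ * inner ℝ (g i) (β i) else 0 := by
      intro j
      by_cases h : grp i = grp j
      · simp only [h, if_true]
        rw [inner_sub_right]
        ring
      · simp [h, Ne.symm h]
    simp_rw [this]
    rw [← Finset.sum_filter, Finset.sum_const, nsmul_eq_mul, ← mul_assoc]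
    rw [mul_inv_cancel₀ (hNpos i).ne', one_mul]
  have hfirst : ∀ i j, (if grp i = grp j then (N i)⁻¹ * inner ℝ (g i) (β i - β j) else 0) ≤
      B * (if grp i = grp j then ‖β i - β j‖ else 0) := by
    intro i j
    split_ifs
    · have h1 := real_inner_le_norm (g i) (β i - β j)
      have h2 : ‖g i‖ * ‖β i - β j‖ ≤ N i * B * ‖β i - β j‖ :=
        mul_le_mul_of_nonneg_right (hB i) (norm_nonneg _)
      rw [inv_mul_le_iff₀ (hNpos i), ← mul_assoc]
      exact h1.trans h2
    · simp
  rw [Finset.sum_congr rfl fun i _ => hmain i, Finset.sum_add_distrib, hzero, add_zero]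
  refine (Finset.sum_le_sum fun i _ => Finset.sum_le_sum fun j _ => hfirst i j).trans ?_
  simp_rw [← Finset.mul_sum]
  rw [sum_sum_eq_two_mul_sum_lt]
  · rw [← mul_assoc, mul_comm B 2]
  · simp
  · intro i j
    simp only [eq_comm (a := grp i), norm_sub_rev (β i)]

end LinearAlgebra

/-! ### The penalty near the origin and in its flat region. -/

section Penalty

variable {pen : ℝ → ℝ → ℝ} {a : ℝ}

theorem PenaltyCondition.at_zero' (h : PenaltyCondition pen a) {μ : ℝ} (hμ : 0 ≤ μ) :
    pen 0 μ = 0 := by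
  rcases hμ.eq_or_lt with rfl | hμ
  · exact h.tuning_zero 0
  · simpa [hμ.ne'] using h.at_zero μ hμ

theorem PenaltyCondition.eq_of_le (h : PenaltyCondition pen a) {μ : ℝ} (hμ : 0 ≤ μ) {s t : ℝ}
    (hs : a * μ ≤ s) (ht : a * μ ≤ t) : pen s μ = pen t μ := by
  rcases hμ.eq_or_lt with rfl | hμ
  · rw [h.tuning_zero, h.tuning_zero]
  · have := (h.flat μ hμ s hs).trans (h.flat μ hμ t ht).symm
    exact mul_left_cancel₀ (inv_ne_zero hμ.ne') this

/-- Near the origin the penalty dominates a linear function. -/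
theorem PenaltyCondition.exists_linear_lower_bound (h : PenaltyCondition pen a) {μ : ℝ}
    (hμ : 0 < μ) : ∃ δ > 0, ∀ t, 0 ≤ t → t < δ → μ / 2 * t ≤ pen t μ := by
  have hev := (h.deriv_zero μ hμ).eventually (lt_mem_nhds (show (1 / 2 : ℝ) < 1 by norm_num))
  obtain ⟨δ, hδ, hδ'⟩ := mem_nhdsGT_iff_exists_Ioo_subset.1 hev
  have hδ0 : 0 < δ := hδ
  refine ⟨δ, hδ0, fun t ht0 htδ => ?_⟩
  rcases ht0.eq_or_lt with rfl | ht
  · rw [h.at_zero' hμ.le]; simp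
  set ρ : ℝ → ℝ := fun t => μ⁻¹ * pen t μ with hρ
  -- `deriv` is 0 where the function is not differentiable, so a derivative above 1/2 forces
  -- differentiability on the whole interval.
  have hdiff : ∀ u ∈ Set.Ioo 0 δ, DifferentiableAt ℝ ρ u := fun u hu => by
    by_contra hcon
    have h1 := hδ' hu
    simp only [Set.mem_ofPred_eq] at h1
    rw [deriv_zero_of_not_differentiableAt hcon] at h1
    norm_num at h1
  have hstep : ∀ s, 0 < s → s < t → (t - s) / 2 ≤ ρ t := by
    intro s hs hst
    have hmv := (convex_Icc s t).mul_sub_le_image_sub_of_le_deriv (f := ρ) (C := 1 / 2)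
      (fun u hu => (hdiff u ⟨hs.trans_le hu.1, hu.2.trans_lt htδ⟩).continuousAt.continuousWithinAt)
      (fun u hu => by
        rw [interior_Icc] at hu
        exact (hdiff u ⟨hs.trans hu.1, hu.2.trans htδ⟩).differentiableWithinAt)
      (fun u hu => by
        rw [interior_Icc] at hu
        exact (hδ' ⟨hs.trans hu.1, hu.2.trans htδ⟩ : (1 / 2 : ℝ) < deriv ρ u).le)
      s (Set.left_mem_Icc.2 hst.le) t (Set.right_mem_Icc.2 hst.le) hst.le
    have hs0 : 0 ≤ ρ s := by
      have := h.monotone μ hμ (Set.mem_Ici.2 le_rfl) (Set.mem_Ici.2 hs.le) hs.le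
      simp only [h.at_zero μ hμ] at this
      exact this
    linarith
  -- The left endpoint s is sent to 0. Only ρ s ≥ 0 is used, so continuity of ρ at the origin is not
  -- needed.
  have hlim : t / 2 ≤ ρ t := by
    refine le_of_forall_pos_lt_add fun e he => ?_
    have := hstep (min (t / 2) e) (lt_min (by linarith) he)
      ((min_le_left _ _).trans_lt (by linarith))
    have h2 := min_le_right (t / 2) e
    linarith
  have : μ * (t / 2) ≤ μ * ρ t := mul_le_mul_of_nonneg_left hlim hμ.le
  rw [hρ] at this
  simp only [mul_inv_cancel_left₀ hμ.ne'] at this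
  linarith

end Penalty

/-! ### Normal equations and deterministic local minimality of the oracle. -/

namespace SpatialModel

section Deterministic

variable {n : ℕ} (D : SpatialModel n)

/-- The true parameter `(η⁰, α⁰)` as a vector in `ℝ^(q + K p)`. -/
def trueParam : D.Par → ℝ := Sum.elim (fun l => D.η0 l) fun kl => D.α0 kl.1 kl.2

/-- The local score `n_i⁻¹ ∑_h r_ih x_ih` of residuals `r`. -/
def score (r : D.Obs → ℝ) (i : Fin n) : EuclideanSpace ℝ (Fin D.p) :=
  ∑ h, ((D.m i : ℝ)⁻¹ * r ⟨i, h⟩) • D.x i h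

theorem Umat_inl (s : D.Obs) (l : Fin D.q) : D.Umat s (Sum.inl l) = D.z s.1 s.2 l := rfl

theorem Umat_inr (s : D.Obs) (kl : Fin D.K × Fin D.p) :
    D.Umat s (Sum.inr kl) = if D.group s.1 = kl.1 then D.x s.1 s.2 kl.2 else 0 := by
  simp only [Umat, Matrix.fromCols_apply_inr, Matrix.mul_apply, Xmat, Wmat, Wtilde,
    Matrix.of_apply, Matrix.kroneckerMap_apply, Matrix.one_apply, Fintype.sum_prod_type]
  rw [Finset.sum_eq_single s.1 (fun i _ hi => by simp [hi.symm]) (by simp),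
    Finset.sum_eq_single kl.2 (fun l _ hl => by simp [hl]) (by simp)]
  simp

theorem Umat_mulVec (b : D.Par → ℝ) (s : D.Obs) :
    (D.Umat *ᵥ b) s = inner ℝ (D.z s.1 s.2) (WithLp.toLp 2 fun l => b (Sum.inl l)) +
      inner ℝ (D.x s.1 s.2) (WithLp.toLp 2 fun l => b (Sum.inr (D.group s.1, l))) := by
  simp only [Matrix.mulVec, dotProduct, Fintype.sum_sum_type, Umat_inl, Umat_inr, PiLp.inner_apply,
    Fintype.sum_prod_type]
  congr 1
  · exact Finset.sum_congr rfl fun l _ => by simp [mul_comm]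
  · rw [Finset.sum_eq_single (D.group s.1) (fun k _ hk => by simp [hk.symm]) (by simp)]
    exact Finset.sum_congr rfl fun l _ => by simp [mul_comm]

theorem response_eq (e : D.Obs → ℝ) : D.response e = D.Umat *ᵥ D.trueParam + e := by
  funext s
  rw [Pi.add_apply, Umat_mulVec]
  rfl

theorem gram_mulVec (b : D.Par → ℝ) :
    D.gram *ᵥ b = D.Umatᵀ *ᵥ (D.Omega *ᵥ (D.Umat *ᵥ b)) := by
  simp [gram, Matrix.mulVec_mulVec, Matrix.mul_assoc]

theorem oracle_response (hdet : IsUnit D.gram.det) (e : D.Obs → ℝ) :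
    D.oracle (D.response e) = D.trueParam + D.gram⁻¹ *ᵥ (D.Umatᵀ *ᵥ (D.Omega *ᵥ e)) := by
  rw [oracle, response_eq, Matrix.mulVec_add, Matrix.mulVec_add, Matrix.mulVec_add, ← gram_mulVec,
    Matrix.mulVec_mulVec, Matrix.nonsing_inv_mul _ hdet, Matrix.one_mulVec]

theorem deviation_oracle (y : D.Obs → ℝ) :
    D.deviation (D.oracleEta y) (D.oracleAlpha y) = D.oracle y - D.trueParam := by
  funext r
  rcases r with l | kl <;> rfl

theorem normal_equations (hdet : IsUnit D.gram.det) (y : D.Obs → ℝ) :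
    D.Umatᵀ *ᵥ (D.Omega *ᵥ (y - D.Umat *ᵥ D.oracle y)) = 0 := by
  rw [Matrix.mulVec_sub, Matrix.mulVec_sub, ← gram_mulVec, oracle, Matrix.mulVec_mulVec _ D.gram,
    Matrix.mul_nonsing_inv _ hdet, Matrix.one_mulVec, sub_self]

theorem transpose_Umat_mulVec_Omega (r : D.Obs → ℝ) (t : D.Par) :
    (D.Umatᵀ *ᵥ (D.Omega *ᵥ r)) t = ∑ s, ((D.m s.1 : ℝ)⁻¹ * D.Umat s t) * r s := by
  simp only [Matrix.mulVec, dotProduct, Matrix.transpose_apply, Omega]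
  refine Finset.sum_congr rfl fun s _ => ?_
  rw [Finset.sum_eq_single s (fun s' _ hs => by simp [Matrix.diagonal_apply_ne' _ hs]) (by simp),
    Matrix.diagonal_apply_eq]
  ring

/-- These are the normal equations in the block α_k, since U repeats the covariates of a location
only in the block of its group. -/
theorem group_sum_score_eq_zero {r : D.Obs → ℝ} (hr : D.Umatᵀ *ᵥ (D.Omega *ᵥ r) = 0)
    (k : Fin D.K) : ∑ i ∈ Finset.univ.filter (fun i => D.group i = k), D.score r i = 0 := by
  ext l
  have h := congrFun hr (Sum.inr (k, l))
  rw [transpose_Umat_mulVec_Omega, Fintype.sum_sigma] at h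
  rw [Finset.sum_filter]
  simp only [WithLp.ofLp_sum, Finset.sum_apply, PiLp.zero_apply]
  rw [Pi.zero_apply] at h
  rw [← h]
  refine Finset.sum_congr rfl fun i _ => ?_
  simp only [Umat_inr]
  split_ifs with hi
  · simp only [score, WithLp.ofLp_sum, Finset.sum_apply, WithLp.ofLp_smul, Pi.smul_apply,
      smul_eq_mul]
    exact Finset.sum_congr rfl fun h _ => by ring
  · simp

theorem sum_eta_score_eq_zero {r : D.Obs → ℝ} (hr : D.Umatᵀ *ᵥ (D.Omega *ᵥ r) = 0) :
    ∑ i, ∑ h, ((D.m i : ℝ)⁻¹ * r ⟨i, h⟩) • D.z i h = 0 := by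
  ext l
  have h := congrFun hr (Sum.inl l)
  rw [transpose_Umat_mulVec_Omega, Fintype.sum_sigma] at h
  simp only [WithLp.ofLp_sum, Finset.sum_apply, PiLp.zero_apply]
  rw [Pi.zero_apply] at h
  rw [← h]
  refine Finset.sum_congr rfl fun i _ => Finset.sum_congr rfl fun h _ => ?_
  simp only [Umat_inl, WithLp.ofLp_smul, Pi.smul_apply, smul_eq_mul]
  ring

theorem minGroup_le (k : Fin D.K) : D.minGroup ≤ D.groupSize k :=
  ciInf_le (OrderBot.bddBelow _) k

/-- The weighted least squares part of the objective. -/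
def lossPart (y : D.Obs → ℝ) (η : EuclideanSpace ℝ (Fin D.q))
    (β : Fin n → EuclideanSpace ℝ (Fin D.p)) : ℝ :=
  (1 / 2) * ∑ i, (1 / (D.m i : ℝ)) *
      ∑ h, (y ⟨i, h⟩ - inner ℝ (D.z i h) η - inner ℝ (D.x i h) (β i)) ^ 2

/-- The sum of the distances within groups. -/
def withinGroup (β : Fin n → EuclideanSpace ℝ (Fin D.p)) : ℝ :=
  ∑ i, ∑ j ∈ Finset.univ.filter (fun j => i < j),
    if D.group i = D.group j then ‖β i - β j‖ else 0

/-- The loss is expanded around the oracle and its quadratic term dropped. The remaining linear term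
involves only the scores and is absorbed by within-group distances. -/
theorem lossPart_oracle_le (hdet : IsUnit D.gram.det) (y : D.Obs → ℝ) {κ : ℝ} (hκ : 0 ≤ κ)
    (hscore : ∀ i, ‖D.score (y - D.Umat *ᵥ D.oracle y) i‖ ≤ D.minGroup * (κ / 2))
    (η : EuclideanSpace ℝ (Fin D.q)) (β : Fin n → EuclideanSpace ℝ (Fin D.p)) :
    D.lossPart y (D.oracleEta y) (D.oracleBeta y) ≤ D.lossPart y η β + κ * D.withinGroup β := by
  set r : D.Obs → ℝ := y - D.Umat *ᵥ D.oracle y with hr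
  have hne : D.Umatᵀ *ᵥ (D.Omega *ᵥ r) = 0 := D.normal_equations hdet y
  have hB : ∀ i, ‖D.score r i‖ ≤
      ((Finset.univ.filter fun j => D.group j = D.group i).card : ℝ) * (κ / 2) := fun i => by
    refine (hscore i).trans (mul_le_mul_of_nonneg_right ?_ (by positivity))
    exact_mod_cast D.minGroup_le (D.group i)
  have hinner := sum_inner_le_of_group_sum_eq_zero D.group (D.score r) β
    (D.group_sum_score_eq_zero hne) hB
  have horacle : ∑ i, inner ℝ (D.score r i) (D.oracleBeta y i) = 0 := by
    rw [← Finset.sum_fiberwise (s := Finset.univ) (g := D.group)]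
    refine Finset.sum_eq_zero fun k _ => ?_
    have : ∀ i ∈ Finset.univ.filter (fun i => D.group i = k),
        inner ℝ (D.score r i) (D.oracleBeta y i) =
        inner ℝ (D.score r i) (D.oracleAlpha y k) := fun i hi => by
      rw [oracleBeta, (Finset.mem_filter.1 hi).2]
    rw [Finset.sum_congr rfl this, ← sum_inner, D.group_sum_score_eq_zero hne, inner_zero_left]
  have hres : ∀ i h, r ⟨i, h⟩ = y ⟨i, h⟩ - inner ℝ (D.z i h) (D.oracleEta y) -
      inner ℝ (D.x i h) (D.oracleBeta y i) := fun i h => by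
    rw [hr, Pi.sub_apply, Umat_mulVec, ← sub_sub]
    rfl
  have hcross : ∑ i, (D.m i : ℝ)⁻¹ * ∑ h, r ⟨i, h⟩ * (inner ℝ (D.z i h) (η - D.oracleEta y) +
      inner ℝ (D.x i h) (β i - D.oracleBeta y i)) = ∑ i, inner ℝ (D.score r i) (β i) := by
    have h1 : ∀ i, (D.m i : ℝ)⁻¹ * ∑ h, r ⟨i, h⟩ * (inner ℝ (D.z i h) (η - D.oracleEta y) +
        inner ℝ (D.x i h) (β i - D.oracleBeta y i)) =
        inner ℝ (∑ h, ((D.m i : ℝ)⁻¹ * r ⟨i, h⟩) • D.z i h) (η - D.oracleEta y) +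
        inner ℝ (D.score r i) (β i - D.oracleBeta y i) := fun i => by
      rw [score, sum_inner, sum_inner, ← Finset.sum_add_distrib, Finset.mul_sum]
      refine Finset.sum_congr rfl fun h _ => ?_
      rw [real_inner_smul_left, real_inner_smul_left]
      ring
    rw [Finset.sum_congr rfl fun i _ => h1 i, Finset.sum_add_distrib, ← sum_inner,
      D.sum_eta_score_eq_zero hne, inner_zero_left, zero_add]
    -- The oracle β is constant on groups, so it pairs to zero with the scores.
    simp_rw [inner_sub_right]
    rw [Finset.sum_sub_distrib, horacle, sub_zero]
  have hpoint : ∀ i, (1 / (D.m i : ℝ)) * ∑ h, r ⟨i, h⟩ ^ 2 -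
      2 * ((D.m i : ℝ)⁻¹ * ∑ h, r ⟨i, h⟩ * (inner ℝ (D.z i h) (η - D.oracleEta y) +
      inner ℝ (D.x i h) (β i - D.oracleBeta y i))) ≤
      (1 / (D.m i : ℝ)) *
        ∑ h, (y ⟨i, h⟩ - inner ℝ (D.z i h) η - inner ℝ (D.x i h) (β i)) ^ 2 := fun i => by
    rw [one_div, mul_left_comm, ← mul_sub, Finset.mul_sum, ← Finset.sum_sub_distrib]
    refine mul_le_mul_of_nonneg_left (Finset.sum_le_sum fun h _ => ?_) (by positivity)
    have : y ⟨i, h⟩ - inner ℝ (D.z i h) η - inner ℝ (D.x i h) (β i) =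
        r ⟨i, h⟩ - (inner ℝ (D.z i h) (η - D.oracleEta y) +
          inner ℝ (D.x i h) (β i - D.oracleBeta y i)) := by
      rw [hres, inner_sub_right, inner_sub_right]
      ring
    rw [this]
    nlinarith [sq_nonneg (inner ℝ (D.z i h) (η - D.oracleEta y) +
          inner ℝ (D.x i h) (β i - D.oracleBeta y i))]
  have hsum := Finset.sum_le_sum fun i (_ : i ∈ Finset.univ) => hpoint i
  rw [Finset.sum_sub_distrib, ← Finset.mul_sum, hcross] at hsum
  unfold lossPart
  simp_rw [← hres]
  have hw : 2 * (κ / 2) * D.withinGroup β = κ * D.withinGroup β := by ring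
  unfold withinGroup at hw ⊢
  linarith

variable {D} in
/-- On a good event the oracle estimator is a local minimizer of the objective. -/
theorem isLocalMin_objective_oracle {pen : ℝ → ℝ → ℝ} {a c₀ lam : ℝ}
    (hpen : PenaltyCondition pen a) (hc₀ : 0 < c₀) (hlam : 0 < lam) (hdet : IsUnit D.gram.det)
    (y : D.Obs → ℝ) {c : Fin n → Fin n → ℝ} (hc : ∀ i j, 0 ≤ c i j)
    (hsame : ∀ i j, i < j → D.group i = D.group j → c₀ ≤ c i j)
    (hdiff : ∀ i j, i < j → D.group i ≠ D.group j →
      a * (c i j * lam) < ‖D.oracleBeta y i - D.oracleBeta y j‖)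
    (hscore : ∀ i, ‖D.score (y - D.Umat *ᵥ D.oracle y) i‖ ≤ D.minGroup * (c₀ * lam / 4)) :
    IsLocalMin
      (fun θ : EuclideanSpace ℝ (Fin D.q) × (Fin n → EuclideanSpace ℝ (Fin D.p)) =>
        D.objective y pen c lam θ.1 θ.2) (D.oracleEta y, D.oracleBeta y) := by
  set κ : ℝ := c₀ * lam / 2 with hκ
  have hκ0 : 0 ≤ κ := by positivity
  have hpair : ∀ i j, ∀ᶠ θ : EuclideanSpace ℝ (Fin D.q) × (Fin n → EuclideanSpace ℝ (Fin D.p)) in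
      𝓝 (D.oracleEta y, D.oracleBeta y), i < j →
      pen ‖D.oracleBeta y i - D.oracleBeta y j‖ (c i j * lam) +
        κ * (if D.group i = D.group j then ‖θ.2 i - θ.2 j‖ else 0) ≤
      pen ‖θ.2 i - θ.2 j‖ (c i j * lam) := by
    intro i j
    have hcont : Continuous fun θ : EuclideanSpace ℝ (Fin D.q) ×
        (Fin n → EuclideanSpace ℝ (Fin D.p)) => ‖θ.2 i - θ.2 j‖ := by fun_prop
    have htend := hcont.tendsto (D.oracleEta y, D.oracleBeta y)
    by_cases hij : i < j
    swap
    · exact Eventually.of_forall fun _ h => absurd h hij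
    by_cases hg : D.group i = D.group j
    · have hμ : 0 < c i j * lam := mul_pos (hc₀.trans_le (hsame i j hij hg)) hlam
      -- Inside a group the oracle distance is 0 and the slope is at least c₀ * lam / 2, which is κ.
      obtain ⟨δ, hδ, hlow⟩ := hpen.exists_linear_lower_bound hμ
      have heq : D.oracleBeta y i = D.oracleBeta y j := by simp only [oracleBeta, hg]
      simp only [heq, sub_self, norm_zero] at htend ⊢
      filter_upwards [htend.eventually (gt_mem_nhds hδ)] with θ hθ _
      rw [hpen.at_zero' hμ.le, zero_add, if_pos hg]
      refine le_trans (mul_le_mul_of_nonneg_right ?_ (norm_nonneg _)) (hlow _ (norm_nonneg _) hθ)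
      have := mul_le_mul_of_nonneg_right (hsame i j hij hg) hlam.le
      linarith
    -- Across groups the strict separation persists nearby, so the penalty keeps its flat value.
    · filter_upwards [htend.eventually (lt_mem_nhds (hdiff i j hij hg))] with θ hθ _
      rw [if_neg hg, mul_zero, add_zero]
      exact (hpen.eq_of_le (mul_nonneg (hc i j) hlam.le) (hdiff i j hij hg).le hθ.le).le
  have hall := (eventually_all (ι := Fin n)).2 fun i => (eventually_all (ι := Fin n)).2 (hpair i)
  filter_upwards [hall] with θ hθ
  have hloss := D.lossPart_oracle_le hdet y hκ0 (fun i => by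
    refine (hscore i).trans_eq ?_
    rw [hκ]; ring) θ.1 θ.2
  have hsum : ∑ i, ∑ j ∈ Finset.univ.filter (fun j => i < j),
      pen ‖D.oracleBeta y i - D.oracleBeta y j‖ (c i j * lam) + κ * D.withinGroup θ.2 ≤
      ∑ i, ∑ j ∈ Finset.univ.filter (fun j => i < j), pen ‖θ.2 i - θ.2 j‖ (c i j * lam) := by
    rw [withinGroup, Finset.mul_sum, ← Finset.sum_add_distrib]
    refine Finset.sum_le_sum fun i _ => ?_
    rw [Finset.mul_sum, ← Finset.sum_add_distrib]
    exact Finset.sum_le_sum fun j hj => hθ i j (Finset.mem_filter.1 hj).2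
  unfold objective
  unfold lossPart at hloss
  linarith

end Deterministic

end SpatialModel

/-! ### Bounds on the oracle error, the residual scores and the error weights. -/

namespace SpatialModel

section Bounds

variable {n : ℕ} (D : SpatialModel n)

theorem minGroup_pos (hn : 0 < n) : 0 < D.minGroup := by
  have : Nonempty (Fin D.K) := ⟨D.group ⟨0, hn⟩⟩
  obtain ⟨k, hk⟩ : D.minGroup ∈ Set.range D.groupSize := Nat.sInf_mem (Set.range_nonempty _)
  rw [← hk]
  obtain ⟨i, hi⟩ := D.group_surj k
  exact Finset.card_pos.2 ⟨i, by simp [hi]⟩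

theorem minRep_pos (hn : 0 < n) : 0 < D.minRep := by
  have : Nonempty (Fin n) := ⟨⟨0, hn⟩⟩
  obtain ⟨i, hi⟩ : D.minRep ∈ Set.range D.m := Nat.sInf_mem (Set.range_nonempty _)
  rw [← hi]
  exact D.m_pos i

theorem minRep_le (i : Fin n) : D.minRep ≤ D.m i := ciInf_le (OrderBot.bddBelow _) i

theorem le_maxRep (i : Fin n) : D.m i ≤ D.maxRep := le_ciSup (Set.finite_range D.m).bddAbove i

theorem m_cast_pos (i : Fin n) : (0 : ℝ) < D.m i := by exact_mod_cast D.m_pos i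

theorem p_le_dim (i : Fin n) : D.p ≤ D.dim := by
  have hK : 1 ≤ D.K := Fin.pos (D.group i)
  unfold dim
  nlinarith

theorem q_le_dim : D.q ≤ D.dim := Nat.le_add_right _ _

theorem card_par : Fintype.card D.Par = D.dim := by simp [dim]

theorem sq_norm_eta_add_sq_norm_alpha_le (b : D.Par → ℝ) (k : Fin D.K) :
    ‖(WithLp.toLp 2 fun l => b (Sum.inl l) : EuclideanSpace ℝ (Fin D.q))‖ ^ 2 +
      ‖(WithLp.toLp 2 fun l => b (Sum.inr (k, l)) : EuclideanSpace ℝ (Fin D.p))‖ ^ 2 ≤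
      b ⬝ᵥ b := by
  rw [EuclideanSpace.norm_sq_eq, EuclideanSpace.norm_sq_eq, dotProduct, Fintype.sum_sum_type,
    Fintype.sum_prod_type]
  simp only [Real.norm_eq_abs, sq_abs, ← sq]
  gcongr
  exact Finset.single_le_sum (f := fun k => ∑ l, b (Sum.inr (k, l)) ^ 2)
    (fun k _ => Finset.sum_nonneg fun l _ => sq_nonneg _) (Finset.mem_univ k)

variable {D} {M₁ M₂ M₃ C₁ C₁' C₂ C₃ : ℝ}

theorem CovariateCondition.coercive (h : D.CovariateCondition M₁ M₂ M₃ C₁ C₁' C₂ C₃)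
    (b : D.Par → ℝ) : C₁ * D.minGroup * (b ⬝ᵥ b) ≤ b ⬝ᵥ (D.gram *ᵥ b) :=
  mul_dotProduct_le_of_le_eigenvalues D.gram_isHermitian h.eig_lower b

theorem CovariateCondition.isUnit_det (h : D.CovariateCondition M₁ M₂ M₃ C₁ C₁' C₂ C₃)
    (hn : 0 < n) (hC₁ : 0 < C₁) : IsUnit D.gram.det := by
  have hG : (0 : ℝ) < D.minGroup := by exact_mod_cast D.minGroup_pos hn
  have hpd := D.gram_isHermitian.posDef_iff_eigenvalues_pos.2
    fun r => (mul_pos hC₁ hG).trans_le (h.eig_lower r)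
  exact hpd.det_pos.ne'.isUnit

theorem CovariateCondition.abs_Umat_le (h : D.CovariateCondition M₁ M₂ M₃ C₁ C₁' C₂ C₃)
    (hM₁ : 0 ≤ M₁) (s : D.Obs) (t : D.Par) : |D.Umat s t| ≤ M₁ := by
  rcases t with l | kl
  · exact h.z_bdd _ _ _
  · rw [Umat_inr]
    split_ifs
    · exact h.x_bdd _ _ _
    · simpa using hM₁

/-- A row of U meets only η and one block α_k, so the bound involves √q and √p, both at most √(q +
Kp). -/
theorem CovariateCondition.abs_Umat_mulVec_le
    (h : D.CovariateCondition M₁ M₂ M₃ C₁ C₁' C₂ C₃) (hC₂ : 0 ≤ C₂) (hC₃ : 0 ≤ C₃)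
    (b : D.Par → ℝ) (s : D.Obs) :
    |(D.Umat *ᵥ b) s| ≤ (C₂ + C₃) * √(D.dim : ℝ) * √(b ⬝ᵥ b) := by
  have hsq := D.sq_norm_eta_add_sq_norm_alpha_le b (D.group s.1)
  rw [Umat_mulVec]
  set bη : EuclideanSpace ℝ (Fin D.q) := WithLp.toLp 2 fun l => b (Sum.inl l)
  set bα : EuclideanSpace ℝ (Fin D.p) := WithLp.toLp 2 fun l => b (Sum.inr (D.group s.1, l))
  have hη : ‖bη‖ ≤ √(b ⬝ᵥ b) := Real.le_sqrt_of_sq_le (by nlinarith [sq_nonneg ‖bα‖])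
  have hα : ‖bα‖ ≤ √(b ⬝ᵥ b) := Real.le_sqrt_of_sq_le (by nlinarith [sq_nonneg ‖bη‖])
  have hq : √(D.q : ℝ) ≤ √(D.dim : ℝ) := Real.sqrt_le_sqrt (by exact_mod_cast D.q_le_dim)
  have hp : √(D.p : ℝ) ≤ √(D.dim : ℝ) := Real.sqrt_le_sqrt (by exact_mod_cast D.p_le_dim s.1)
  calc _ ≤ ‖D.z s.1 s.2‖ * ‖bη‖ + ‖D.x s.1 s.2‖ * ‖bα‖ :=
        (abs_add_le _ _).trans (add_le_add (abs_real_inner_le_norm _ _)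
          (abs_real_inner_le_norm _ _))
    _ ≤ (C₃ * √(D.dim : ℝ)) * √(b ⬝ᵥ b) + (C₂ * √(D.dim : ℝ)) * √(b ⬝ᵥ b) := by
        gcongr
        · exact (h.z_norm _ _).trans (by gcongr)
        · exact (h.x_norm _ _).trans (by gcongr)
    _ = _ := by ring

/-- Bound on the estimation error in terms of the coordinates of `UᵀΩe`. -/
theorem CovariateCondition.sq_error_le (h : D.CovariateCondition M₁ M₂ M₃ C₁ C₁' C₂ C₃)
    (hn : 0 < n) (hC₁ : 0 < C₁) {c₁ : ℝ} (hc₁ : 0 < c₁) (g : D.Par → ℝ)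
    (hg : ∀ t, |g t| ≤ M₁ * √((n : ℝ) / D.minRep) * √(Real.log n / c₁)) :
    (D.gram⁻¹ *ᵥ g) ⬝ᵥ (D.gram⁻¹ *ᵥ g) ≤ D.phi c₁ C₁ M₁ ^ 2 := by
  have hG : (0 : ℝ) < D.minGroup := by exact_mod_cast D.minGroup_pos hn
  have hlog : 0 ≤ Real.log n := Real.log_natCast_nonneg n
  have h1 := sq_mul_dotProduct_le_of_coercive (mul_pos hC₁ hG).le h.coercive (D.gram⁻¹ *ᵥ g)
  rw [Matrix.mulVec_mulVec, Matrix.mul_nonsing_inv _ (h.isUnit_det hn hC₁),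
    Matrix.one_mulVec] at h1
  set T := M₁ * √((n : ℝ) / D.minRep) * √(Real.log n / c₁) with hT
  have h2 : g ⬝ᵥ g ≤ D.dim * T ^ 2 := by
    rw [dotProduct, ← D.card_par, ← nsmul_eq_mul]
    refine Finset.sum_le_card_nsmul _ _ _ fun t _ => ?_
    rw [← sq, ← sq_abs]
    exact pow_le_pow_left₀ (abs_nonneg _) (hg t) 2
  -- φ is exactly the error that coercivity yields when all coordinates of g are at most T.
  have h3 : (C₁ * D.minGroup) ^ 2 * D.phi c₁ C₁ M₁ ^ 2 = D.dim * T ^ 2 := by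
    rw [hT, phi, Real.sqrt_mul (by positivity), Real.sqrt_div hlog]
    have hd := Real.sq_sqrt (Nat.cast_nonneg (α := ℝ) D.dim)
    field_simp
    rw [hd]
    ring
  have h4 : (0 : ℝ) < (C₁ * D.minGroup) ^ 2 := by positivity
  exact le_of_mul_le_mul_left (by linarith) h4

theorem phi_nonneg (D : SpatialModel n) {c₁ : ℝ} (hC₁ : 0 ≤ C₁) (hM₁ : 0 ≤ M₁) :
    0 ≤ D.phi c₁ C₁ M₁ := by
  unfold phi
  positivity

theorem score_sub (D : SpatialModel n) (e u : D.Obs → ℝ) (i : Fin n) :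
    D.score (e - u) i = D.score e i - D.score u i := by
  simp only [score, Pi.sub_apply, mul_sub, sub_smul, Finset.sum_sub_distrib]

/-- A score is an average over the repeated measures, so their number cancels. -/
theorem norm_score_le (D : SpatialModel n) {u : D.Obs → ℝ} {A B : ℝ}
    (hx : ∀ i h, ‖D.x i h‖ ≤ A) (hu : ∀ s, |u s| ≤ B) (i : Fin n) :
    ‖D.score u i‖ ≤ A * B := by
  have hm := D.m_cast_pos i
  have hterm : ∀ h, ‖((D.m i : ℝ)⁻¹ * u ⟨i, h⟩) • D.x i h‖ ≤ (D.m i : ℝ)⁻¹ * (A * B) := by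
    intro h
    rw [norm_smul, Real.norm_eq_abs, abs_mul, abs_of_pos (inv_pos.2 hm), mul_assoc]
    refine mul_le_mul_of_nonneg_left ?_ (inv_pos.2 hm).le
    rw [mul_comm A]
    exact mul_le_mul (hu _) (hx _ _) (norm_nonneg _) ((abs_nonneg _).trans (hu ⟨i, h⟩))
  refine (norm_sum_le_of_le _ fun h _ => hterm h).trans_eq ?_
  rw [Finset.sum_const, Finset.card_univ, Fintype.card_fin, nsmul_eq_mul, ← mul_assoc,
    mul_inv_cancel₀ hm.ne', one_mul]

theorem norm_le_sqrt_mul_of_abs_le {p : ℕ} {u : EuclideanSpace ℝ (Fin p)} {T : ℝ} (hT : 0 ≤ T)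
    (hu : ∀ l, |u l| ≤ T) : ‖u‖ ≤ √(p : ℝ) * T := by
  rw [EuclideanSpace.norm_eq, Real.sqrt_le_left (by positivity), mul_pow,
    Real.sq_sqrt (Nat.cast_nonneg _)]
  have := Finset.sum_le_card_nsmul Finset.univ (fun l => ‖u l‖ ^ 2) (T ^ 2) fun l _ => by
    rw [Real.norm_eq_abs]
    exact pow_le_pow_left₀ (abs_nonneg _) (hu l) 2
  simpa using this

/-- The residual is the error minus the fitted error U b. The first score is bounded coordinatewise,
the second through ‖b‖ ≤ φ; enlarging 1/`minRep` to n/`minRep` lets φ absorb the first. -/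
theorem CovariateCondition.norm_score_residual_le
    (h : D.CovariateCondition M₁ M₂ M₃ C₁ C₁' C₂ C₃)
    (hn : 0 < n) (hC₁ : 0 < C₁) (hM₁ : 0 < M₁) (hC₂ : 0 < C₂) (hC₃ : 0 < C₃) {c₁ : ℝ}
    (hc₁ : 0 < c₁) (e : D.Obs → ℝ) (b : D.Par → ℝ) (hb : b ⬝ᵥ b ≤ D.phi c₁ C₁ M₁ ^ 2)
    (hscore : ∀ i l, |D.score e i l| ≤ M₁ * √(1 / (D.minRep : ℝ)) * √(3 * Real.log n / c₁))
    (i : Fin n) :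
    ‖D.score (e - D.Umat *ᵥ b) i‖ ≤
      D.phi c₁ C₁ M₁ * (√3 * C₁ * D.minGroup + C₂ * (C₂ + C₃) * D.dim) := by
  have hG : (0 : ℝ) < D.minGroup := by exact_mod_cast D.minGroup_pos hn
  have hφ := D.phi_nonneg (c₁ := c₁) hC₁.le hM₁.le
  have hlog : 0 ≤ Real.log n := Real.log_natCast_nonneg n
  have hsb : √(b ⬝ᵥ b) ≤ D.phi c₁ C₁ M₁ := by
    rw [Real.sqrt_le_left hφ]; exact hb
  have hp : √(D.p : ℝ) ≤ √(D.dim : ℝ) := Real.sqrt_le_sqrt (by exact_mod_cast D.p_le_dim i)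
  have h1 : ‖D.score (D.Umat *ᵥ b) i‖ ≤ D.phi c₁ C₁ M₁ * (C₂ * (C₂ + C₃) * D.dim) := by
    have := D.norm_score_le (A := C₂ * √(D.dim : ℝ))
      (fun i h' => (h.x_norm i h').trans (by gcongr)) (h.abs_Umat_mulVec_le hC₂.le hC₃.le b) i
    refine this.trans ?_
    have hd := Real.mul_self_sqrt (Nat.cast_nonneg (α := ℝ) D.dim)
    calc _ ≤ C₂ * √(D.dim : ℝ) * ((C₂ + C₃) * √(D.dim : ℝ) * D.phi c₁ C₁ M₁) := by gcongr
      _ = D.phi c₁ C₁ M₁ * (C₂ * (C₂ + C₃) * (√(D.dim : ℝ) * √(D.dim : ℝ))) := by ring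
      _ = _ := by rw [hd]
  have h2 : ‖D.score e i‖ ≤ D.phi c₁ C₁ M₁ * (√3 * C₁ * D.minGroup) := by
    refine (norm_le_sqrt_mul_of_abs_le (by positivity) (hscore i)).trans ?_
    have hn1 : (1 : ℝ) ≤ n := by exact_mod_cast hn
    calc √(D.p : ℝ) * (M₁ * √(1 / (D.minRep : ℝ)) * √(3 * Real.log n / c₁))
        ≤ √(D.dim : ℝ) * (M₁ * √((n : ℝ) / (D.minRep : ℝ)) * √(3 * Real.log n / c₁)) := by
          gcongr
      _ = _ := by
          rw [phi, Real.sqrt_mul (by positivity : (0 : ℝ) ≤ (n : ℝ) / D.minRep),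
            Real.sqrt_div (by positivity : 0 ≤ 3 * Real.log n), Real.sqrt_mul (by norm_num)]
          field_simp
  rw [score_sub]
  refine (norm_sub_le _ _).trans ((add_le_add h2 h1).trans_eq ?_)
  ring

/-- The coefficient of `ε_s` in `vᵀ((η̂ - η⁰)ᵀ, (α̂ - α⁰)ᵀ)ᵀ`. -/
def errorWeight (D : SpatialModel n) (v : D.Par → ℝ) (s : D.Obs) : ℝ :=
  (D.m s.1 : ℝ)⁻¹ * (D.Umat *ᵥ (D.gram⁻¹ *ᵥ v)) s

theorem gram_inv_transpose (D : SpatialModel n) : D.gram⁻¹ᵀ = D.gram⁻¹ := by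
  rw [Matrix.transpose_nonsing_inv]
  congr 1
  rw [← Matrix.conjTranspose_eq_transpose_of_trivial]
  exact D.gram_isHermitian

theorem errorWeight_eq (D : SpatialModel n) (v : D.Par → ℝ) :
    D.errorWeight v = D.Omega *ᵥ (D.Umat *ᵥ (D.gram⁻¹ *ᵥ v)) := by
  funext s
  rw [errorWeight, Omega, Matrix.mulVec_diagonal]

theorem transpose_Omega (D : SpatialModel n) : D.Omegaᵀ = D.Omega := Matrix.diagonal_transpose _

theorem dotProduct_gram_inv (D : SpatialModel n) (v : D.Par → ℝ) (e : D.Obs → ℝ) :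
    v ⬝ᵥ (D.gram⁻¹ *ᵥ (D.Umatᵀ *ᵥ (D.Omega *ᵥ e))) = ∑ s, D.errorWeight v s * e s := by
  change _ = D.errorWeight v ⬝ᵥ e
  rw [errorWeight_eq, Matrix.dotProduct_mulVec, ← Matrix.mulVec_transpose, gram_inv_transpose,
    Matrix.dotProduct_mulVec, Matrix.vecMul_transpose, Matrix.dotProduct_mulVec,
    ← Matrix.mulVec_transpose, transpose_Omega]

theorem sigmaN_eq (D : SpatialModel n) (σ : ℝ) (v : D.Par → ℝ) :
    D.sigmaN σ v = σ * √(∑ s, D.errorWeight v s ^ 2) := by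
  have h : (D.gram⁻¹ * (D.Umatᵀ * D.Omega * D.Omega * D.Umat) * D.gram⁻¹) *ᵥ v =
      D.gram⁻¹ *ᵥ (D.Umatᵀ *ᵥ (D.Omega *ᵥ D.errorWeight v)) := by
    simp only [errorWeight_eq, Matrix.mulVec_mulVec, Matrix.mul_assoc]
  rw [sigmaN, h, dotProduct_gram_inv]
  simp only [sq]

/-- Each squared weight is a small fraction of the sum of the squared weights. -/
theorem CovariateCondition.sq_errorWeight_le (h : D.CovariateCondition M₁ M₂ M₃ C₁ C₁' C₂ C₃)
    (hn : 0 < n) (hC₁ : 0 < C₁) (hC₂ : 0 < C₂) (hC₃ : 0 < C₃) (v : D.Par → ℝ)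
    (s : D.Obs) :
    C₁ * D.minGroup * D.errorWeight v s ^ 2 ≤
      M₃ * (C₂ + C₃) ^ 2 * D.dim * ∑ s, D.errorWeight v s ^ 2 := by
  have hG : (0 : ℝ) < D.minGroup := by exact_mod_cast D.minGroup_pos hn
  have hmin : (0 : ℝ) < D.minRep := by exact_mod_cast D.minRep_pos hn
  have hmax : (0 : ℝ) < D.maxRep :=
    (D.m_cast_pos ⟨0, hn⟩).trans_le (by exact_mod_cast D.le_maxRep _)
  set b := D.gram⁻¹ *ᵥ v with hb
  have hbb : 0 ≤ b ⬝ᵥ b := Finset.sum_nonneg fun i _ => mul_self_nonneg _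
  -- The quadratic form of the Gram matrix at b is the sum of n_i times the squared weights, hence
  -- the factor `maxRep`. It is offset below by `minRep` through the bounded ratio M₃.
  have hlow : C₁ * D.minGroup * (b ⬝ᵥ b) ≤ D.maxRep * ∑ s, D.errorWeight v s ^ 2 := by
    refine (h.coercive b).trans ?_
    have e1 : b ⬝ᵥ (D.gram *ᵥ b) = ∑ s, (D.m s.1 : ℝ)⁻¹ * (D.Umat *ᵥ b) s ^ 2 := by
      rw [gram_mulVec, Matrix.dotProduct_mulVec, Matrix.vecMul_transpose, dotProduct]
      refine Finset.sum_congr rfl fun s _ => ?_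
      rw [Omega, Matrix.mulVec_diagonal]
      ring
    rw [e1, Finset.mul_sum]
    refine Finset.sum_le_sum fun s _ => ?_
    have hm := D.m_cast_pos s.1
    have hle : (D.m s.1 : ℝ) ≤ D.maxRep := by exact_mod_cast D.le_maxRep s.1
    rw [errorWeight, ← hb, mul_pow, ← mul_assoc]
    refine mul_le_mul_of_nonneg_right ?_ (sq_nonneg _)
    rw [sq, ← mul_assoc]
    refine le_mul_of_one_le_left (inv_pos.2 hm).le ?_
    rw [← div_eq_mul_inv, one_le_div hm]
    exact hle
  have hup : D.minRep * D.errorWeight v s ^ 2 ≤ (C₂ + C₃) ^ 2 * D.dim * (b ⬝ᵥ b) := by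
    have hm := D.m_cast_pos s.1
    have hm1 : (1 : ℝ) ≤ D.m s.1 := by exact_mod_cast D.m_pos s.1
    have hle : (D.minRep : ℝ) ≤ D.m s.1 := by exact_mod_cast D.minRep_le s.1
    have h1 := pow_le_pow_left₀ (abs_nonneg _) (h.abs_Umat_mulVec_le hC₂.le hC₃.le b s) 2
    rw [sq_abs, mul_pow, mul_pow, Real.sq_sqrt (Nat.cast_nonneg _), Real.sq_sqrt hbb] at h1
    refine le_trans ?_ h1
    rw [errorWeight, ← hb, mul_pow, ← mul_assoc]
    refine mul_le_of_le_one_left (sq_nonneg _) ?_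
    rw [inv_pow, ← div_eq_mul_inv, div_le_one (by positivity)]
    nlinarith
  have hratio : (D.maxRep : ℝ) ≤ M₃ * D.minRep := (div_le_iff₀ hmin).1 h.rep_upper
  have hS : 0 ≤ ∑ s, D.errorWeight v s ^ 2 := Finset.sum_nonneg fun i _ => sq_nonneg _
  have : (D.minRep : ℝ) * (C₁ * D.minGroup * D.errorWeight v s ^ 2) ≤
      D.minRep * (M₃ * (C₂ + C₃) ^ 2 * D.dim * ∑ s, D.errorWeight v s ^ 2) := by
    calc (D.minRep : ℝ) * (C₁ * D.minGroup * D.errorWeight v s ^ 2)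
        = C₁ * D.minGroup * (D.minRep * D.errorWeight v s ^ 2) := by ring
      _ ≤ C₁ * D.minGroup * ((C₂ + C₃) ^ 2 * D.dim * (b ⬝ᵥ b)) := by gcongr
      _ = (C₂ + C₃) ^ 2 * D.dim * (C₁ * D.minGroup * (b ⬝ᵥ b)) := by ring
      _ ≤ (C₂ + C₃) ^ 2 * D.dim * (M₃ * D.minRep * ∑ s, D.errorWeight v s ^ 2) := by
          refine mul_le_mul_of_nonneg_left (hlow.trans ?_) (by positivity)
          gcongr
      _ = _ := by ring
  exact le_of_mul_le_mul_left this hmin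

/-- If all weights vanished, applying Uᵀ to them would recover v = 0. This makes the normalization
by `sigmaN` legitimate. -/
theorem CovariateCondition.sum_sq_errorWeight_pos
    (h : D.CovariateCondition M₁ M₂ M₃ C₁ C₁' C₂ C₃) (hn : 0 < n) (hC₁ : 0 < C₁)
    {v : D.Par → ℝ} (hv : v ≠ 0) : 0 < ∑ s, D.errorWeight v s ^ 2 := by
  have hG : (0 : ℝ) < D.minGroup := by exact_mod_cast D.minGroup_pos hn
  have hdet := h.isUnit_det hn hC₁
  have hS : 0 ≤ ∑ s, D.errorWeight v s ^ 2 := Finset.sum_nonneg fun i _ => sq_nonneg _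
  refine hS.lt_of_ne' fun h0 => hv ?_
  have hzero : D.errorWeight v = 0 := by
    funext s
    have := (Finset.sum_eq_zero_iff_of_nonneg fun i _ => sq_nonneg _).1 h0 s (Finset.mem_univ s)
    exact pow_eq_zero_iff two_ne_zero |>.1 this
  have hgram : D.gram *ᵥ (D.gram⁻¹ *ᵥ v) = 0 := by
    rw [gram_mulVec, ← errorWeight_eq, hzero, Matrix.mulVec_zero]
  rwa [Matrix.mulVec_mulVec, Matrix.mul_nonsing_inv _ hdet, Matrix.one_mulVec] at hgram

end Bounds

end SpatialModel

/-! ### Union bounds and vanishing probabilities. -/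

section Events

variable {Ω : Type*} [MeasurableSpace Ω] {P : Measure Ω}

/-- Union bound for finitely many linear combinations of sub-Gaussian errors. -/
theorem SubGaussianTails.measure_exists_lt_le {ι τ : Type*} [Fintype ι] [Fintype τ] {c₁ : ℝ}
    {ε : ι → Ω → ℝ} (h : SubGaussianTails P c₁ ε) (v : τ → ι → ℝ) {L x : ℝ} (hL : 0 ≤ L)
    (hv : ∀ t, ∑ s, v t s ^ 2 ≤ L ^ 2) (hx : 0 < x) :
    P {ω | ∃ t, L * x < |∑ s, v t s * ε s ω|} ≤
      ENNReal.ofReal (Fintype.card τ * (2 * Real.exp (-c₁ * x ^ 2))) := by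
  have hsub : {ω | ∃ t, L * x < |∑ s, v t s * ε s ω|} ⊆
      ⋃ t, {ω | L * x < |∑ s, v t s * ε s ω|} := fun ω ⟨t, ht⟩ => Set.mem_iUnion.2 ⟨t, ht⟩
  refine (measure_mono hsub).trans ((measure_iUnion_fintype_le _ _).trans ?_)
  have hterm : ∀ t, P {ω | L * x < |∑ s, v t s * ε s ω|} ≤
      ENNReal.ofReal (2 * Real.exp (-c₁ * x ^ 2)) := fun t => by
    refine (measure_mono fun ω hω => ?_).trans (h (WithLp.toLp 2 (v t)) x hx)
    refine lt_of_le_of_lt (mul_le_mul_of_nonneg_right ?_ hx.le) hω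
    rw [EuclideanSpace.norm_eq, Real.sqrt_le_left hL]
    simpa using hv t
  refine (Finset.sum_le_sum fun t _ => hterm t).trans_eq ?_
  rw [Finset.sum_const, Finset.card_univ, nsmul_eq_mul, ENNReal.ofReal_mul (Nat.cast_nonneg _),
    ENNReal.ofReal_natCast]

theorem tendsto_measure_zero_of_eventually_subset {A B : ℕ → Set Ω}
    (hB : Tendsto (fun n => P (B n)) atTop (𝓝 0)) (h : ∀ᶠ n in atTop, A n ⊆ B n) :
    Tendsto (fun n => P (A n)) atTop (𝓝 0) :=
  tendsto_of_tendsto_of_tendsto_of_le_of_le' tendsto_const_nhds hB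
    (Eventually.of_forall fun _ => zero_le) (h.mono fun _ hn => measure_mono hn)

theorem tendsto_measure_union_zero {A B : ℕ → Set Ω}
    (hA : Tendsto (fun n => P (A n)) atTop (𝓝 0)) (hB : Tendsto (fun n => P (B n)) atTop (𝓝 0)) :
    Tendsto (fun n => P (A n ∪ B n)) atTop (𝓝 0) := by
  have := hA.add hB
  rw [add_zero] at this
  exact tendsto_of_tendsto_of_tendsto_of_le_of_le tendsto_const_nhds this
    (fun _ => zero_le) fun _ => measure_union_le _ _

end Events

/-! ### Tail bounds for the coordinates of UᵀΩε and for the scores. -/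

namespace SpatialModel

section Events

variable {Ω : Type*} [MeasurableSpace Ω] {P : Measure Ω} {n : ℕ} {D : SpatialModel n}
  {M₁ M₂ M₃ C₁ C₁' C₂ C₃ : ℝ}

/-- Location i contributes at most M₁²/n_i to the squared norm of a column of ΩU. The level log n /
c₁ gives each of the q + Kp coordinates probability at most 2/n. -/
theorem CovariateCondition.measure_coordinate_le
    (h : D.CovariateCondition M₁ M₂ M₃ C₁ C₁' C₂ C₃) (hn : 2 ≤ n) (hM₁ : 0 < M₁) {c₁ : ℝ}
    (hc₁ : 0 < c₁) {ε : D.Obs → Ω → ℝ} (hε : SubGaussianTails P c₁ ε) :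
    P {ω | ∃ t, M₁ * √((n : ℝ) / D.minRep) * √(Real.log n / c₁) <
      |(D.Umatᵀ *ᵥ (D.Omega *ᵥ fun s => ε s ω)) t|} ≤ ENNReal.ofReal (2 * (D.dim / n)) := by
  have hn1 : (1 : ℝ) < n := by exact_mod_cast hn
  have hlog : 0 < Real.log n := Real.log_pos hn1
  have hmin : (0 : ℝ) < D.minRep := by exact_mod_cast D.minRep_pos (by omega)
  have hmain := hε.measure_exists_lt_le (fun (t : D.Par) s => (D.m s.1 : ℝ)⁻¹ * D.Umat s t)
    (L := M₁ * √((n : ℝ) / D.minRep)) (x := √(Real.log n / c₁)) (by positivity) (fun t => ?_)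
    (Real.sqrt_pos.2 (by positivity))
  · simp only [transpose_Umat_mulVec_Omega]
    refine hmain.trans_eq ?_
    rw [D.card_par, Real.sq_sqrt (by positivity), neg_mul, mul_div_cancel₀ _ hc₁.ne', Real.exp_neg,
      Real.exp_log (by linarith)]
    congr 1
    ring
  · rw [mul_pow, Real.sq_sqrt (by positivity), Fintype.sum_sigma]
    have hi : ∀ i, ∑ h', ((D.m i : ℝ)⁻¹ * D.Umat ⟨i, h'⟩ t) ^ 2 ≤ M₁ ^ 2 / D.minRep := by
      intro i
      have hm := D.m_cast_pos i
      have hle : (D.minRep : ℝ) ≤ D.m i := by exact_mod_cast D.minRep_le i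
      have : ∀ h' ∈ Finset.univ, ((D.m i : ℝ)⁻¹ * D.Umat ⟨i, h'⟩ t) ^ 2 ≤
          ((D.m i : ℝ)⁻¹) ^ 2 * M₁ ^ 2 := fun h' _ => by
        rw [mul_pow]
        refine mul_le_mul_of_nonneg_left ?_ (sq_nonneg _)
        rw [← sq_abs]
        exact pow_le_pow_left₀ (abs_nonneg _) (h.abs_Umat_le hM₁.le _ _) 2
      refine (Finset.sum_le_card_nsmul _ _ _ this).trans ?_
      rw [Finset.card_univ, Fintype.card_fin, nsmul_eq_mul]
      calc _ = M₁ ^ 2 / D.m i := by field_simp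
        _ ≤ _ := by gcongr
    refine (Finset.sum_le_card_nsmul _ _ _ fun i _ => hi i).trans_eq ?_
    rw [Finset.card_univ, Fintype.card_fin, nsmul_eq_mul]
    ring

theorem score_apply (e : D.Obs → ℝ) (i : Fin n) (l : Fin D.p) :
    D.score e i l =
      ∑ s : D.Obs, (if s.1 = i then (D.m s.1 : ℝ)⁻¹ * D.x s.1 s.2 l else 0) * e s := by
  rw [Fintype.sum_sigma, Finset.sum_eq_single i (fun j _ hj => by simp [hj]) (by simp)]
  simp only [score, WithLp.ofLp_sum, Finset.sum_apply, WithLp.ofLp_smul, Pi.smul_apply,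
    smul_eq_mul, if_true]
  exact Finset.sum_congr rfl fun h _ => by ring

/-- Only one location enters a score, so its squared norm lacks the factor n. The factor 3 in the
level gives tails of order n⁻³, enough for the np coordinates. -/
theorem CovariateCondition.measure_score_le
    (h : D.CovariateCondition M₁ M₂ M₃ C₁ C₁' C₂ C₃) (hn : 2 ≤ n) (hM₁ : 0 < M₁) {c₁ : ℝ}
    (hc₁ : 0 < c₁) {ε : D.Obs → Ω → ℝ} (hε : SubGaussianTails P c₁ ε) :
    P {ω | ∃ il : Fin n × Fin D.p, M₁ * √(1 / (D.minRep : ℝ)) * √(3 * Real.log n / c₁) <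
      |D.score (fun s => ε s ω) il.1 il.2|} ≤ ENNReal.ofReal (2 * (D.dim / n)) := by
  have hn1 : (1 : ℝ) < n := by exact_mod_cast hn
  have hlog : 0 < Real.log n := Real.log_pos hn1
  have hmin : (0 : ℝ) < D.minRep := by exact_mod_cast D.minRep_pos (by omega)
  have hmain := hε.measure_exists_lt_le (fun (il : Fin n × Fin D.p) (s : D.Obs) =>
      if s.1 = il.1 then (D.m s.1 : ℝ)⁻¹ * D.x s.1 s.2 il.2 else 0)
    (L := M₁ * √(1 / (D.minRep : ℝ))) (x := √(3 * Real.log n / c₁)) (by positivity) (fun il => ?_)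
    (Real.sqrt_pos.2 (by positivity))
  · simp only [score_apply]
    refine hmain.trans (ENNReal.ofReal_le_ofReal ?_)
    have hexp : Real.exp (-(3 * Real.log n)) = ((n : ℝ) ^ 3)⁻¹ := by
      rw [Real.exp_neg, mul_comm, Real.exp_mul, Real.exp_log (by linarith)]
      norm_cast
    rw [Real.sq_sqrt (by positivity), neg_mul, mul_div_cancel₀ _ hc₁.ne', hexp, Fintype.card_prod,
      Fintype.card_fin, Fintype.card_fin, Nat.cast_mul]
    have hp : (D.p : ℝ) ≤ D.dim := by exact_mod_cast D.p_le_dim ⟨0, by omega⟩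
    calc (n : ℝ) * D.p * (2 * ((n : ℝ) ^ 3)⁻¹) = 2 * (D.p / (n : ℝ) ^ 2) := by field_simp
      _ ≤ 2 * (D.dim / (n : ℝ)) := by
        gcongr
        nlinarith
  · rw [mul_pow, Real.sq_sqrt (by positivity), Fintype.sum_sigma,
      Finset.sum_eq_single il.1 (fun j _ hj => by simp [hj]) (by simp)]
    have hm := D.m_cast_pos il.1
    have hle : (D.minRep : ℝ) ≤ D.m il.1 := by exact_mod_cast D.minRep_le il.1
    have : ∀ h' ∈ Finset.univ,
        (if il.1 = il.1 then (D.m il.1 : ℝ)⁻¹ * D.x il.1 h' il.2 else 0) ^ 2 ≤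
        ((D.m il.1 : ℝ)⁻¹) ^ 2 * M₁ ^ 2 := fun h' _ => by
      rw [if_pos rfl, mul_pow]
      refine mul_le_mul_of_nonneg_left ?_ (sq_nonneg _)
      rw [← sq_abs]
      exact pow_le_pow_left₀ (abs_nonneg _) (h.x_bdd _ _ _) 2
    refine (Finset.sum_le_card_nsmul _ _ _ this).trans ?_
    rw [Finset.card_univ, Fintype.card_fin, nsmul_eq_mul]
    calc _ = M₁ ^ 2 * (1 / D.m il.1) := by field_simp
      _ ≤ _ := by gcongr

end Events

/-! ### Measurability of the oracle estimators. -/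

section Measurability

variable {Ω : Type*} [MeasurableSpace Ω] {n : ℕ} (D : SpatialModel n)

theorem measurable_oracle_response {ε : D.Obs → Ω → ℝ} (hε : ∀ s, Measurable (ε s)) (t : D.Par) :
    Measurable fun ω => D.oracle (D.response fun s => ε s ω) t := by
  simp only [oracle, Matrix.mulVec, dotProduct, response]
  fun_prop

theorem measurable_oracleEta {ε : D.Obs → Ω → ℝ} (hε : ∀ s, Measurable (ε s)) :
    Measurable fun ω => D.oracleEta (D.response fun s => ε s ω) := by
  refine (WithLp.measurable_toLp 2 _).comp (measurable_pi_lambda _ fun l => ?_)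
  exact D.measurable_oracle_response hε _

theorem measurable_oracleAlpha {ε : D.Obs → Ω → ℝ} (hε : ∀ s, Measurable (ε s)) :
    Measurable fun ω => D.oracleAlpha (D.response fun s => ε s ω) := by
  refine measurable_pi_lambda _ fun k => ?_
  refine (WithLp.measurable_toLp 2 _).comp (measurable_pi_lambda _ fun l => ?_)
  exact D.measurable_oracle_response hε _

theorem measurable_oracleBeta {ε : D.Obs → Ω → ℝ} (hε : ∀ s, Measurable (ε s)) :
    Measurable fun ω => D.oracleBeta (D.response fun s => ε s ω) :=
  measurable_pi_lambda _ fun i => (measurable_pi_apply (D.group i)).comp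
    (D.measurable_oracleAlpha hε)

end Measurability

/-! ### Separation of the estimated groups. -/

section Separation

variable {n : ℕ} {D : SpatialModel n} {M₁ M₂ M₃ C₁ C₁' C₂ C₃ : ℝ}

theorem norm_oracleAlpha_sub_le {φ : ℝ} (hφ : 0 ≤ φ) {y : D.Obs → ℝ} {b : D.Par → ℝ}
    (hy : D.oracle y = D.trueParam + b) (hb : b ⬝ᵥ b ≤ φ ^ 2) (k : Fin D.K) :
    ‖D.oracleAlpha y k - D.α0 k‖ ≤ φ := by
  have h : D.oracleAlpha y k - D.α0 k = WithLp.toLp 2 fun l => b (Sum.inr (k, l)) := by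
    ext l
    simp only [oracleAlpha, hy, PiLp.sub_apply, Pi.add_apply, trueParam, Sum.elim_inr]
    ring
  rw [h]
  have := D.sq_norm_eta_add_sq_norm_alpha_le b k
  refine (sq_le_sq₀ (norm_nonneg _) hφ).1 ?_
  nlinarith [sq_nonneg ‖(WithLp.toLp 2 fun l => b (Sum.inl l) : EuclideanSpace ℝ (Fin D.q))‖]

/-- Groups that are separated by more than `A + 2 φ` in truth are separated by more than `A` in
any `φ`-accurate estimate. -/
theorem lt_norm_sub_of_separated {E : Type*} [NormedAddCommGroup E] {u v u' v' : E} {A φ : ℝ}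
    (hu : ‖u' - u‖ ≤ φ) (hv : ‖v' - v‖ ≤ φ) (h : A + 2 * φ < ‖u - v‖) : A < ‖u' - v'‖ := by
  have h1 : ‖u - v‖ ≤ ‖u - u'‖ + ‖u' - v'‖ + ‖v' - v‖ := by
    have : u - v = (u - u') + (u' - v') + (v' - v) := by abel
    rw [this]
    exact norm_add₃_le
  rw [norm_sub_rev u u'] at h1
  linarith

theorem isDistinctGroupVectors_oracle {y : D.Obs → ℝ}
    (h : ∀ i j, i < j → D.group i ≠ D.group j → D.oracleBeta y i ≠ D.oracleBeta y j) :
    D.IsDistinctGroupVectors (D.oracleBeta y) (D.oracleAlpha y) := by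
  refine ⟨fun k k' hkk => ?_, ?_, fun i => rfl⟩
  · by_contra hne
    obtain ⟨i, rfl⟩ := D.group_surj k
    obtain ⟨j, rfl⟩ := D.group_surj k'
    rcases lt_trichotomy i j with hij | rfl | hij
    · exact h i j hij hne hkk
    · exact hne rfl
    · exact h j i hij (Ne.symm hne) hkk.symm
  · exact (D.group_surj.range_comp (D.oracleAlpha y)).symm

end Separation

end SpatialModel

end

/-! ### Moments and tails of single errors, and the main theorem. -/

theorem ErrorModel.integrable_sq {ι Ω : Type*} [MeasurableSpace Ω] {P : Measure Ω}
    [IsFiniteMeasure P] {σ : ℝ} {ε : ι → Ω → ℝ} (h : ErrorModel P σ ε) (hσ : 0 < σ) (s : ι) :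
    Integrable (fun ω => ε s ω ^ 2) P := by
  -- `variance` takes the value 0 for variables outside L², so σ² > 0 already yields square
  -- integrability.
  have hv : variance (ε s) P ≠ 0 := by rw [h.var]; positivity
  exact (memLp_two_of_variance_ne_zero (h.meas s).aestronglyMeasurable hv).integrable_sq

theorem ErrorModel.integral_sq {ι Ω : Type*} [MeasurableSpace Ω] {P : Measure Ω} {σ : ℝ}
    {ε : ι → Ω → ℝ} (h : ErrorModel P σ ε) (s : ι) :
    ∫ ω, ε s ω ^ 2 ∂P = σ ^ 2 := by
  rw [← h.var s, variance_of_integral_eq_zero (h.meas s).aemeasurable (h.mean s)]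

theorem SubGaussianTails.measure_lt_abs_le {ι Ω : Type*} [Fintype ι] [MeasurableSpace Ω]
    {P : Measure Ω} {c₁ : ℝ} {ε : ι → Ω → ℝ} (h : SubGaussianTails P c₁ ε) (s : ι) {x : ℝ}
    (hx : 0 < x) : P {ω | x < |ε s ω|} ≤ ENNReal.ofReal (2 * Real.exp (-c₁ * x ^ 2)) := by
  classical
  simpa using h (EuclideanSpace.single s 1) x hx

theorem mainTheorem3 {Ω : Type*} [MeasurableSpace Ω] (P : Measure Ω) [IsProbabilityMeasure P]
    (D : (n : ℕ) → SpatialModel n)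
    (ε : (n : ℕ) → (D n).Obs → Ω → ℝ)
    (pen : ℝ → ℝ → ℝ)
    (c : (n : ℕ) → Ω → Fin n → Fin n → ℝ)
    (lam : ℕ → ℝ)
    (σ a c₀ c₁ M₁ M₂ M₃ C₁ C₁' C₂ C₃ : ℝ)
    (hσ : 0 < σ) (ha : 0 < a) (hc₀ : 0 < c₀) (hc₁ : 0 < c₁)
    (hM₁ : 0 < M₁) (hM₂ : 0 < M₂) (hM₃ : 0 < M₃)
    (hC₁ : 0 < C₁) (hC₁' : 0 < C₁') (hC₂ : 0 < C₂) (hC₃ : 0 < C₃)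
    (hmodel : ∀ n, ErrorModel P σ (ε n))
    (hcond1 : PenaltyCondition pen a)
    (hcond2 : ∀ᶠ n in atTop, (D n).CovariateCondition M₁ M₂ M₃ C₁ C₁' C₂ C₃)
    (hcond3 : ∀ n, SubGaussianTails P c₁ (ε n))
    (hc_nonneg : ∀ n ω i j, 0 ≤ c n ω i j)
    (hcond4 : Tendsto (fun n => P {ω | ∃ i j, i < j ∧ (D n).group i = (D n).group j ∧
      c n ω i j < c₀}) atTop (𝓝 0))
    (hgroup : Tendsto (fun n => √((D n).dim : ℝ) *
      max √((n : ℝ) / ((D n).minRep : ℝ) * Real.log n) √((D n).dim : ℝ) /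
        ((D n).minGroup : ℝ)) atTop (𝓝 0))
    (hq : Tendsto (fun n => ((D n).q : ℝ) / (n : ℝ)) atTop (𝓝 0))
    (hKp : Tendsto (fun n => (((D n).K * (D n).p : ℕ) : ℝ) / (n : ℝ)) atTop (𝓝 0))
    (hlam_pos : ∀ n, 0 < lam n)
    (hlam : Tendsto (fun n => (D n).phi c₁ C₁ M₁ / lam n) atTop (𝓝 0))
    (hsep : Tendsto (fun n => P {ω | ∃ i j, i < j ∧ (D n).group i ≠ (D n).group j ∧
      ‖(D n).α0 ((D n).group i) - (D n).α0 ((D n).group j)‖ ≤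
        a * (c n ω i j * lam n) + 2 * (D n).phi c₁ C₁ M₁}) atTop (𝓝 0)) :
    ∃ (ηhat : (n : ℕ) → Ω → EuclideanSpace ℝ (Fin (D n).q))
      (βhat : (n : ℕ) → Ω → Fin n → EuclideanSpace ℝ (Fin (D n).p))
      (αhat : (n : ℕ) → Ω → Fin (D n).K → EuclideanSpace ℝ (Fin (D n).p)),
      (∀ n, Measurable (ηhat n)) ∧ (∀ n, Measurable (βhat n)) ∧ (∀ n, Measurable (αhat n)) ∧
      Tendsto (fun n => P {ω | ¬ IsLocalMin
        (fun θ : EuclideanSpace ℝ (Fin (D n).q) × (Fin n → EuclideanSpace ℝ (Fin (D n).p)) =>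
          (D n).objective ((D n).response fun s => ε n s ω) pen (c n ω) (lam n) θ.1 θ.2)
        (ηhat n ω, βhat n ω)}) atTop (𝓝 0) ∧
      Tendsto (fun n => P {ω | ¬ (ηhat n ω = (D n).oracleEta ((D n).response fun s => ε n s ω) ∧
        βhat n ω = (D n).oracleBeta ((D n).response fun s => ε n s ω))}) atTop (𝓝 0) ∧
      Tendsto (fun n => P {ω | ¬ (D n).IsDistinctGroupVectors (βhat n ω) (αhat n ω)})
        atTop (𝓝 0) ∧
      ∀ v : (n : ℕ) → (D n).Par → ℝ, (∀ᶠ n in atTop, v n ≠ 0) →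
        TendstoInDistribution
          (fun n ω => ((D n).sigmaN σ (v n))⁻¹ *
            (v n ⬝ᵥ (D n).deviation (ηhat n ω) (αhat n ω)))
          atTop (id : ℝ → ℝ) (fun _ => P) (gaussianReal 0 1) := by
  have hdim_n : Tendsto (fun n => ((D n).dim : ℝ) / n) atTop (𝓝 0) := by
    have := hq.add hKp
    rw [add_zero] at this
    refine this.congr fun n => ?_
    rw [← add_div, SpatialModel.dim, Nat.cast_add]
  -- The second entry of the maximum in the group-size condition. It serves both the score bound and
  -- the negligibility of single weights.
  have hdim_G : Tendsto (fun n => ((D n).dim : ℝ) / (D n).minGroup) atTop (𝓝 0) := by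
    refine squeeze_zero (fun n => by positivity) (fun n => ?_) hgroup
    gcongr
    calc ((D n).dim : ℝ) = √((D n).dim : ℝ) * √((D n).dim : ℝ) :=
          (Real.mul_self_sqrt (Nat.cast_nonneg _)).symm
      _ ≤ _ := by gcongr; exact le_max_right _ _
  have hG_pos : ∀ n, 2 ≤ n → (0 : ℝ) < (D n).minGroup := fun n hn => by
    exact_mod_cast (D n).minGroup_pos (by omega)
  -- The exceptional events and their probabilities.
  set err : (n : ℕ) → Ω → (D n).Par → ℝ := fun n ω =>
    (D n).Umatᵀ *ᵥ ((D n).Omega *ᵥ fun s => ε n s ω) with herr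
  set bad : ℕ → Set Ω := fun n =>
    ({ω | ∃ i j, i < j ∧ (D n).group i = (D n).group j ∧ c n ω i j < c₀} ∪
    {ω | ∃ i j, i < j ∧ (D n).group i ≠ (D n).group j ∧
      ‖(D n).α0 ((D n).group i) - (D n).α0 ((D n).group j)‖ ≤
        a * (c n ω i j * lam n) + 2 * (D n).phi c₁ C₁ M₁}) ∪
    ({ω | ∃ t, M₁ * √((n : ℝ) / (D n).minRep) * √(Real.log n / c₁) < |err n ω t|} ∪
    {ω | ∃ il : Fin n × Fin (D n).p,
      M₁ * √(1 / ((D n).minRep : ℝ)) * √(3 * Real.log n / c₁) <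
      |(D n).score (fun s => ε n s ω) il.1 il.2|}) with hbad
  have hbound : Tendsto (fun n => ENNReal.ofReal (2 * (((D n).dim : ℝ) / n))) atTop (𝓝 0) := by
    have := ENNReal.tendsto_ofReal (hdim_n.const_mul 2)
    simpa using this
  have hbad_lim : Tendsto (fun n => P (bad n)) atTop (𝓝 0) := by
    refine tendsto_measure_union_zero (tendsto_measure_union_zero hcond4 hsep)
      (tendsto_measure_union_zero ?_ ?_)
    · refine tendsto_of_tendsto_of_tendsto_of_le_of_le' tendsto_const_nhds hbound
        (Eventually.of_forall fun _ => zero_le) ?_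
      filter_upwards [hcond2, eventually_ge_atTop 2] with n hn hn2
      exact hn.measure_coordinate_le hn2 hM₁ hc₁ (hcond3 n)
    · refine tendsto_of_tendsto_of_tendsto_of_le_of_le' tendsto_const_nhds hbound
        (Eventually.of_forall fun _ => zero_le) ?_
      filter_upwards [hcond2, eventually_ge_atTop 2] with n hn hn2
      exact hn.measure_score_le hn2 hM₁ hc₁ (hcond3 n)
  have hrate : ∀ᶠ n in atTop, (D n).phi c₁ C₁ M₁ * (√3 * C₁ * (D n).minGroup +
      C₂ * (C₂ + C₃) * (D n).dim) ≤ (D n).minGroup * (c₀ * lam n / 4) := by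
    -- Once q + Kp ≤ |G_min| the bracket is at most A |G_min|, so φ ≤ c₀λ/(4A) suffices.
    set A : ℝ := √3 * C₁ + C₂ * (C₂ + C₃) with hA
    have hA0 : 0 < A := by positivity
    filter_upwards [hdim_G.eventually (ge_mem_nhds one_pos),
      hlam.eventually (ge_mem_nhds (show (0 : ℝ) < c₀ / (4 * A) by positivity)),
      eventually_ge_atTop 2] with n h1 h2 hn2
    have hG := hG_pos n hn2
    rw [div_le_one hG] at h1
    rw [div_le_iff₀ (hlam_pos n)] at h2
    have hφ := (D n).phi_nonneg (c₁ := c₁) hC₁.le hM₁.le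
    have hl := hlam_pos n
    calc (D n).phi c₁ C₁ M₁ * (√3 * C₁ * (D n).minGroup + C₂ * (C₂ + C₃) * (D n).dim)
        ≤ c₀ / (4 * A) * lam n *
          (√3 * C₁ * (D n).minGroup + C₂ * (C₂ + C₃) * (D n).minGroup) := by gcongr
      _ = c₀ / (4 * A) * lam n * (A * (D n).minGroup) := by rw [hA]; ring
      _ = _ := by field_simp
  -- Off the exceptional events the oracle estimator is accurate.
  have hgood : ∀ᶠ n in atTop, ∀ ω ∉ bad n,
      (∀ i j, i < j → (D n).group i = (D n).group j → c₀ ≤ c n ω i j) ∧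
      (∀ i j, i < j → (D n).group i ≠ (D n).group j → a * (c n ω i j * lam n) <
        ‖(D n).oracleBeta ((D n).response fun s => ε n s ω) i -
          (D n).oracleBeta ((D n).response fun s => ε n s ω) j‖) ∧
      IsLocalMin
        (fun θ : EuclideanSpace ℝ (Fin (D n).q) × (Fin n → EuclideanSpace ℝ (Fin (D n).p)) =>
          (D n).objective ((D n).response fun s => ε n s ω) pen (c n ω) (lam n) θ.1 θ.2)
        ((D n).oracleEta ((D n).response fun s => ε n s ω),
          (D n).oracleBeta ((D n).response fun s => ε n s ω)) := by
    filter_upwards [hcond2, hrate, eventually_ge_atTop 2] with n hn hr hn2 ω hω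
    have hn0 : 0 < n := by omega
    simp only [hbad, Set.mem_union, Set.mem_ofPred_eq, not_or, not_exists, not_and, not_lt,
      not_le] at hω
    obtain ⟨⟨hw1, hw2⟩, hw3, hw4⟩ := hω
    have hdet := hn.isUnit_det hn0 hC₁
    set e : (D n).Obs → ℝ := fun s => ε n s ω with he
    have hφ := (D n).phi_nonneg (c₁ := c₁) hC₁.le hM₁.le
    have hb := hn.sq_error_le hn0 hC₁ hc₁ (err n ω) hw3
    have hy := (D n).oracle_response hdet e
    have hα := SpatialModel.norm_oracleAlpha_sub_le hφ hy hb
    have hdiff : ∀ i j, i < j → (D n).group i ≠ (D n).group j → a * (c n ω i j * lam n) <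
        ‖(D n).oracleBeta ((D n).response e) i - (D n).oracleBeta ((D n).response e) j‖ :=
      fun i j hij hg => SpatialModel.lt_norm_sub_of_separated (hα _) (hα _) (hw2 i j hij hg)
    refine ⟨hw1, hdiff, ?_⟩
    refine SpatialModel.isLocalMin_objective_oracle hcond1 hc₀ (hlam_pos n) hdet _
      (hc_nonneg n ω) hw1 hdiff fun i => ?_
    have hres : (D n).response e - (D n).Umat *ᵥ (D n).oracle ((D n).response e) =
        e - (D n).Umat *ᵥ ((D n).gram⁻¹ *ᵥ err n ω) := by
      rw [hy, (D n).response_eq, Matrix.mulVec_add]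
      abel
    rw [hres]
    exact (hn.norm_score_residual_le hn0 hC₁ hM₁ hC₂ hC₃ hc₁ e _ hb
      (fun i l => hw4 (i, l)) i).trans hr
  refine ⟨fun n ω => (D n).oracleEta ((D n).response fun s => ε n s ω),
    fun n ω => (D n).oracleBeta ((D n).response fun s => ε n s ω),
    fun n ω => (D n).oracleAlpha ((D n).response fun s => ε n s ω),
    fun n => (D n).measurable_oracleEta (hmodel n).meas,
    fun n => (D n).measurable_oracleBeta (hmodel n).meas,
    fun n => (D n).measurable_oracleAlpha (hmodel n).meas, ?_, ?_, ?_, ?_⟩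
  · refine tendsto_measure_zero_of_eventually_subset hbad_lim (hgood.mono fun n hn ω hω => ?_)
    by_contra hcon
    exact hω (hn ω hcon).2.2
  -- The witnesses are the oracle estimators, so the exceptional set is empty.
  · simp
  · refine tendsto_measure_zero_of_eventually_subset hbad_lim (hgood.mono fun n hn ω hω => ?_)
    by_contra hcon
    refine hω (SpatialModel.isDistinctGroupVectors_oracle fun i j hij hg heq => ?_)
    have h1 := (hn ω hcon).2.1 i j hij hg
    rw [heq, sub_self, norm_zero] at h1
    exact absurd h1 (not_lt.2 (mul_nonneg ha.le (mul_nonneg (hc_nonneg n ω i j) (hlam_pos n).le)))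
  · intro v hv
    obtain ⟨C, hC⟩ := exists_third_moment_bound (P := P) hc₁
    have hthird := fun n s => hC (ε n s) ((hmodel n).meas s)
      fun x hx => (hcond3 n).measure_lt_abs_le s hx
    set w : (n : ℕ) → (D n).Obs → ℝ := fun n s =>
      ((D n).sigmaN σ (v n))⁻¹ * (D n).errorWeight (v n) s with hw
    have hpos : ∀ᶠ n in atTop, 0 < ∑ s, (D n).errorWeight (v n) s ^ 2 := by
      filter_upwards [hcond2, hv, eventually_ge_atTop 2] with n hn hvn hn2
      exact hn.sum_sq_errorWeight_pos (by omega) hC₁ hvn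
    have hwsq : ∀ n s, 0 < ∑ s, (D n).errorWeight (v n) s ^ 2 → w n s ^ 2 =
        (D n).errorWeight (v n) s ^ 2 / (σ ^ 2 * ∑ s, (D n).errorWeight (v n) s ^ 2) := by
      intro n s hS
      simp only [hw]
      rw [(D n).sigmaN_eq, mul_pow, inv_pow, mul_pow, Real.sq_sqrt hS.le]
      field_simp
    have hlim := tendsto_charFun_weighted_sum (P := P) (w := w) (fun n => (hmodel n).meas)
      (fun n => (hmodel n).indep) (fun n s => (hmodel n).integrable_sq hσ s)
      (fun n s => (hthird n s).1) (fun n => (hmodel n).mean) (fun n s => (hmodel n).integral_sq s)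
      (fun n s => (hthird n s).2) hσ (by
        filter_upwards [hpos] with n hS
        rw [Finset.sum_congr rfl fun s _ => hwsq n s hS, ← Finset.sum_div]
        field_simp) (by
        intro δ hδ
        have hlim0 : Tendsto (fun n => M₃ * (C₂ + C₃) ^ 2 / (σ ^ 2 * C₁) *
            (((D n).dim : ℝ) / (D n).minGroup)) atTop (𝓝 0) := by
          simpa using hdim_G.const_mul (M₃ * (C₂ + C₃) ^ 2 / (σ ^ 2 * C₁))
        filter_upwards [hpos, hcond2, eventually_ge_atTop 2,
          hlim0.eventually (ge_mem_nhds (show 0 < δ ^ 2 by positivity))] with n hS hn hn2 hδn s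
        refine abs_le_of_sq_le_sq (le_trans ?_ hδn) hδ.le
        have hG := hG_pos n hn2
        have := hn.sq_errorWeight_le (by omega) hC₁ hC₂ hC₃ (v n) s
        rw [hwsq n s hS, div_mul_div_comm, div_le_div_iff₀ (by positivity) (by positivity)]
        have hσ2 : 0 ≤ σ ^ 2 := sq_nonneg σ
        nlinarith [mul_le_mul_of_nonneg_left this hσ2])
    have hmeas : ∀ n, Measurable fun ω => ((D n).sigmaN σ (v n))⁻¹ *
        (v n ⬝ᵥ (D n).deviation ((D n).oracleEta ((D n).response fun s => ε n s ω))
          ((D n).oracleAlpha ((D n).response fun s => ε n s ω))) := by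
      intro n
      simp only [(D n).deviation_oracle, dotProduct, Pi.sub_apply]
      have := fun t => (D n).measurable_oracle_response (hmodel n).meas t
      fun_prop
    refine ⟨fun n => (hmeas n).aemeasurable, aemeasurable_id, ?_⟩
    -- Lévy's continuity theorem. The identification with the weighted error sum needs an invertible
    -- Gram matrix, hence holds only for large n.
    refine ProbabilityMeasure.tendsto_iff_tendsto_charFun.2 fun t => ?_
    simp only [ProbabilityMeasure.coe_mk, Measure.map_id]
    refine (hlim t).congr' ?_
    filter_upwards [hcond2, eventually_ge_atTop 2] with n hn hn2
    congr 2
    funext ω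
    rw [(D n).deviation_oracle, (D n).oracle_response (hn.isUnit_det (by omega) hC₁),
      add_sub_cancel_left, (D n).dotProduct_gram_inv, Finset.mul_sum]
    exact Finset.sum_congr rfl fun s _ => mul_assoc _ _ _
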